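/- Let a sensing base station (BS) sit at the origin of $\mathbb{R}^2$, and let the other BSs form a homogeneous Poisson point process $\Phi$ of density $\lambda_{\mathrm{BS}}>0$. Put $p_{\mathrm{LOS}}(r)=e^{-\eta_b r}$ with $\eta_b\ge 0$, and let the $N_b$ beams of width $\theta_b\ge 0$ of a BS not overlap, $N_b\theta_b\le 2\pi$. Independently of everything else, each BS of $\Phi$ is an aligned interferer with probability $N_b\big(\tfrac{\theta_b}{2\pi}\big)^2$, and an aligned interferer at distance $r$ is line-of-sight (LoS) with probability $p_{\mathrm{LOS}}(r)$ and non-line-of-sight (NLoS) otherwise. Let $\Phi_{L}$, $\Phi_{N}$ be the sets of aligned LoS and NLoS interferers. Let $R_I$ be the distance from the origin to the nearest point of $\Phi$; only interferers outside the exclusion disk of radius $R_I$ are counted, so the LoS and NLoS co-channel interference are $$I_{L}=P_cG_m^2C_L\sum_{i\in\Phi_{L},\,r_i>R_I} g_{L,i}\,r_i^{-\alpha_L},\qquad I_{N}=P_cG_m^2C_N\sum_{i\in\Phi_{N},\,r_i>R_I} g_{N,i}\,r_i^{-\alpha_N},$$ where $r_i$ is the distance of the $i$-th interferer to the origin, $P_c,C_L,C_N\ge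 0$, $G_m,\alpha_L,\alpha_N\in\mathbb{R}$, and $g_{L,i}$, $g_{N,i}$ are independent Nakagami-$m$ power gains, i.e. Gamma variables with mean $1$ and shape $m_L>0$ and $m_N>0$, respectively. Sums and integrals of nonnegative terms may be $+\infty$, and $e^{-\infty}=0$. Define $\xi=2\pi\lambda_{\mathrm{BS}}N_b\big(\tfrac{\theta_b}{2\pi}\big)^2$, $f_{R_I}(r)=2\pi\lambda_{\mathrm{BS}}\,r\,e^{-\pi\lambda_{\mathrm{BS}}r^2}$ and, for $s\ge 0$, $$\mathcal{J}_L(R)=\int_{R}^{\infty}p_{\mathrm{LOS}}(r)\Big[1-\Big(1+\tfrac{sP_cG_m^2C_L r^{-\alpha_L}}{m_L}\Big)^{-m_L}\Big]r\,dr,$$ $$\mathcal{J}_N(R)=\int_{R}^{\infty}\big[1-p_{\mathrm{LOS}}(r)\big]\Big[1-\Big(1+\tfrac{sP_cG_m^2C_N r^{-\alpha_N}}{m_N}\Big)^{-m_N}\Big]r\,dr.$$ Then $R_I$ has density $f_{R_I}$ on $(0,\infty)$. Almost surely, the conditional Laplace transforms $\mathcal{L}_{I_L\mid R_I}(s)=\mathbb{E}[e^{-sI_L}\mid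 R_I]$ and $\mathcal{L}_{I_N\mid R_I}(s)=\mathbb{E}[e^{-sI_N}\mid R_I]$ are equal to $e^{-\xi\mathcal{J}_L(R_I)}$ and $e^{-\xi\mathcal{J}_N(R_I)}$, and $\mathbb{E}[e^{-s(I_L+I_N)}\mid R_I]=\mathcal{L}_{I_L\mid R_I}(s)\,\mathcal{L}_{I_N\mid R_I}(s)$. The Laplace transform of the aggregate co-channel interference at the sensing BS is $$\mathbb{E}\big[e^{-s(I_L+I_N)}\big]=\mathbb{E}\big[\mathcal{L}_{I_L\mid R_I}(s)\,\mathcal{L}_{I_N\mid R_I}(s)\big]=\int_0^\infty \exp\!\big(-\xi[\mathcal{J}_L(R)+\mathcal{J}_N(R)]\big)\,f_{R_I}(R)\,dR.$$ -/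

import Mathlib

open MeasureTheory ProbabilityTheory Set
open scoped ENNReal

noncomputable section

namespace MmWave

/-- `x ↦ e^{-x}` on `[0, ∞]`, with `e^{-∞} = 0`. -/
def expNeg (x : ℝ≥0∞) : ℝ := if x = ∞ then 0 else Real.exp (-x.toReal)

/-- The Laplace transform `s ↦ 𝔼[e^{-s I}]` of a random variable with values in `[0, ∞]`. -/
def laplaceTransform {Ω : Type*} [MeasurableSpace Ω] (P : Measure Ω) (I : Ω → ℝ≥0∞) (s : ℝ) : ℝ :=
  ∫ ω, expNeg (ENNReal.ofReal s * I ω) ∂P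

/-- The conditional Laplace transform `𝔼[e^{-s I} | R]` given a real random variable `R`. -/
def condLaplaceTransform {Ω : Type*} [MeasurableSpace Ω] (P : Measure Ω) (I : Ω → ℝ≥0∞)
    (R : Ω → ℝ) (s : ℝ) : Ω → ℝ :=
  P[fun ω => expNeg (ENNReal.ofReal s * I ω) | MeasurableSpace.comap R inferInstance]

/-- The number of points of the configuration `X 0 ω, X 1 ω, …` that lie in `A`. -/
def pointCount {Ω E : Type*} (X : ℕ → Ω → E) (A : Set E) (ω : Ω) : ℕ∞ :=
  {i : ℕ | X i ω ∈ A}.encard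

/-- The points `X 0, X 1, …` enumerate a Poisson point process with intensity measure `Λ`
(of infinite total mass, so that there are infinitely many points): the number of points in a
measurable set of finite intensity is Poisson distributed, and the numbers of points in finitely
many pairwise disjoint measurable sets are independent. -/
structure IsPoissonPointProcess {Ω E : Type*} [MeasurableSpace Ω] [MeasurableSpace E]
    (P : Measure Ω) (X : ℕ → Ω → E) (Λ : Measure E) : Prop where
  measurable : ∀ i, Measurable (X i)
  poisson : ∀ A : Set E, MeasurableSet A → Λ A ≠ ∞ → ∀ n : ℕ,
    P {ω | pointCount X A ω = n} =
      ENNReal.ofReal (Real.exp (-(Λ A).toReal) * (Λ A).toReal ^ n / (n.factorial : ℝ))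
  indep : ∀ (k : ℕ) (A : Fin k → Set E), (∀ j, MeasurableSet (A j)) →
    Pairwise (fun j l => Disjoint (A j) (A l)) →
    iIndepFun (fun j ω => pointCount X (A j) ω) P

/-- The physical parameters of the network. -/
structure Params where
  /-- density of the base stations (BSs) -/
  lamBS : ℝ
  /-- number of simultaneous beams of each BS -/
  Nb : ℕ
  /-- beamwidth -/
  θb : ℝ
  /-- blockage parameter -/
  ηb : ℝ
  /-- communication power -/
  Pc : ℝ
  /-- maximum antenna gain -/
  Gm : ℝ
  /-- LoS path-loss intercept -/
  CL : ℝ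
  /-- NLoS path-loss intercept -/
  CN : ℝ
  /-- LoS path-loss exponent -/
  αL : ℝ
  /-- NLoS path-loss exponent -/
  αN : ℝ
  /-- LoS Nakagami parameter -/
  mL : ℝ
  /-- NLoS Nakagami parameter -/
  mN : ℝ
  lamBS_pos : 0 < lamBS
  θb_nonneg : 0 ≤ θb
  /-- the beams of one BS do not overlap -/
  beams_le : Nb * θb ≤ 2 * Real.pi
  ηb_nonneg : 0 ≤ ηb
  Pc_nonneg : 0 ≤ Pc
  CL_nonneg : 0 ≤ CL
  CN_nonneg : 0 ≤ CN
  mL_pos : 0 < mL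
  mN_pos : 0 < mN

namespace Params

variable (p : Params)

/-- The LoS probability at distance `r`. -/
def pLOS (r : ℝ) : ℝ := Real.exp (-p.ηb * r)

/-- The probability that one of the `Nb` beams of a BS is aligned with the serving beam. -/
def alignProb : ℝ := p.Nb * (p.θb / (2 * Real.pi)) ^ 2

/-- The constant `ξ`. -/
def ξ : ℝ := 2 * Real.pi * p.lamBS * (p.Nb * (p.θb / (2 * Real.pi)) ^ 2)

/-- The density of the exclusion radius. -/
def fRI (r : ℝ) : ℝ :=
  2 * Real.pi * p.lamBS * r * Real.exp (-(Real.pi * p.lamBS * r ^ 2))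

/-- The integral `J_L(R)`, with value in `[0, ∞]`. -/
def JL (s R : ℝ) : ℝ≥0∞ :=
  ∫⁻ r in Ioi R, ENNReal.ofReal
    (p.pLOS r * (1 - (1 + s * p.Pc * p.Gm ^ 2 * p.CL * r ^ (-p.αL) / p.mL) ^ (-p.mL)) * r)

/-- The integral `J_N(R)`, with value in `[0, ∞]`. -/
def JN (s R : ℝ) : ℝ≥0∞ :=
  ∫⁻ r in Ioi R, ENNReal.ofReal
    ((1 - p.pLOS r) * (1 - (1 + s * p.Pc * p.Gm ^ 2 * p.CN * r ^ (-p.αN) / p.mN) ^ (-p.mN)) * r)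

end Params

/-- The BSs around the sensing BS, which sits at the origin: their locations form a homogeneous
Poisson point process of density `lamBS` in the plane, and independently of the locations they
carry i.i.d. marks. The mark of a BS has four independent components: two uniform variables on
`[0, 1]`, which decide whether the BS is aligned and whether its link is LoS, and the Nakagami
fading power gains of a LoS and of an NLoS link, which are Gamma variables with mean one. -/
structure Network {Ω : Type*} [MeasurableSpace Ω] (P : Measure Ω) (p : Params) where
  /-- location of the `i`-th BS -/
  X : ℕ → Ω → EuclideanSpace ℝ (Fin 2)
  /-- uniform variable that decides on alignment -/
  beam : ℕ → Ω → ℝ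
  /-- uniform variable that decides on blockage -/
  block : ℕ → Ω → ℝ
  /-- LoS fading gain -/
  gL : ℕ → Ω → ℝ
  /-- NLoS fading gain -/
  gN : ℕ → Ω → ℝ
  poisson : IsPoissonPointProcess P X
    (ENNReal.ofReal p.lamBS • (volume : Measure (EuclideanSpace ℝ (Fin 2))))
  measurable_mark : ∀ i, Measurable (fun ω => (beam i ω, block i ω, gL i ω, gN i ω))
  law_mark : ∀ i, P.map (fun ω => (beam i ω, block i ω, gL i ω, gN i ω)) =
    (volume.restrict (Icc (0 : ℝ) 1)).prod ((volume.restrict (Icc (0 : ℝ) 1)).prod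
      ((gammaMeasure p.mL p.mL).prod (gammaMeasure p.mN p.mN)))
  indep_marks : iIndepFun (fun i ω => (beam i ω, block i ω, gL i ω, gN i ω)) P
  indep_points_marks : IndepFun (fun ω i => X i ω)
    (fun ω i => (beam i ω, block i ω, gL i ω, gN i ω)) P

namespace Network

variable {Ω : Type*} [MeasurableSpace Ω] {P : Measure Ω} {p : Params} (N : Network P p)

/-- The exclusion radius: the distance from the sensing BS to the nearest other BS. -/
def RI (ω : Ω) : ℝ := ⨅ i, ‖N.X i ω‖

/-- The indices of the aligned BSs with a LoS link (a thinning with retention probability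
`alignProb * pLOS r` at distance `r`). -/
def ΦL (ω : Ω) : Set ℕ :=
  {i | N.beam i ω ≤ p.alignProb ∧ N.block i ω ≤ p.pLOS ‖N.X i ω‖}

/-- The indices of the aligned BSs with an NLoS link (a thinning with retention probability
`alignProb * (1 - pLOS r)` at distance `r`). -/
def ΦN (ω : Ω) : Set ℕ :=
  {i | N.beam i ω ≤ p.alignProb ∧ p.pLOS ‖N.X i ω‖ < N.block i ω}

open Classical in
/-- The LoS co-channel interference from outside the exclusion disk of radius `RI`. -/
def IL (ω : Ω) : ℝ≥0∞ :=
  ENNReal.ofReal (p.Pc * p.Gm ^ 2 * p.CL) *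
    ∑' i, if i ∈ N.ΦL ω ∧ N.RI ω < ‖N.X i ω‖ then
      ENNReal.ofReal (N.gL i ω * ‖N.X i ω‖ ^ (-p.αL)) else 0

open Classical in
/-- The NLoS co-channel interference from outside the exclusion disk of radius `RI`. -/
def IN (ω : Ω) : ℝ≥0∞ :=
  ENNReal.ofReal (p.Pc * p.Gm ^ 2 * p.CN) *
    ∑' i, if i ∈ N.ΦN ω ∧ N.RI ω < ‖N.X i ω‖ then
      ENNReal.ofReal (N.gN i ω * ‖N.X i ω‖ ^ (-p.αN)) else 0

end Network

end MmWave

end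

/-! Everything follows from the Laplace functional of a Poisson process, E[exp(-∑ f(X_i))] = exp(-∫
(1 - e^{-f}) dΛ), for measurable f with values in [0, ∞] (`IsPoissonPointProcess.laplace`). Allowing
f = ∞ matters: since e^{-∞} = 0, the value ∞ on a ball turns the functional into the indicator that
the ball is empty. Taking f = ∞ on the ball of radius a and an arbitrary f beyond t ≥ a yields both
the law of the nearest distance R and its independence, below the level t, from the points beyond t.

The exclusion radius is random, so t must be replaced by R. On a dyadic cell of values of R, the
upper endpoint is a deterministic t to which the independence applies. Summing over cells and
letting the mesh tend to 0, by right continuity in t, shows that given R the points strictly beyond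
R keep their Poisson Laplace functional
(`IsPoissonPointProcess.setLIntegral_sumBeyond_nearestDist`).

Marks are integrated out with the locations fixed: a marked sum has the same transform as the
unmarked sum of f(x) = -log E[e^{-F(x, mark)}], so the exponent becomes ∫ (1 - E[e^{-F(x, mark)}])
dΛ (`IsPoissonPointProcess.setLIntegral_marked`). For the network, the thinning and Gamma transforms
together with polar coordinates identify this exponent as ξ(J_L + J_N).

Separate weights sL, sN on the two interferences treat all three transforms at once. The exponent is
additive in the LoS and NLoS parts, which is why the conditional transform factorises. -/

namespace MmWave

open Filter Topology

/-! ### The exponential on [0, ∞] -/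

/-- `x ↦ e^{-x}` on `[0, ∞]`, with values in `[0, ∞]`. -/
noncomputable def eexpNeg (x : ℝ≥0∞) : ℝ≥0∞ := ENNReal.ofReal (expNeg x)

lemma expNeg_nonneg (x : ℝ≥0∞) : 0 ≤ expNeg x := by
  unfold expNeg; split_ifs <;> positivity

/-- The extended exponential already treats ∞ correctly, so continuity, monotonicity and
invertibility can be taken from it. -/
lemma eexpNeg_eq_exp (x : ℝ≥0∞) : eexpNeg x = EReal.exp (-(x : EReal)) := by
  induction x with
  | top => simp [eexpNeg, expNeg]
  | coe x =>
    simp only [eexpNeg, expNeg, ENNReal.coe_ne_top, if_false, ENNReal.coe_toReal]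
    rw [← EReal.exp_coe]
    rfl

lemma continuous_eexpNeg : Continuous eexpNeg := by
  have : eexpNeg = fun x : ℝ≥0∞ => EReal.exp (-(x : EReal)) := funext eexpNeg_eq_exp
  rw [this]
  exact ENNReal.continuous_exp.comp (continuous_neg.comp continuous_coe_ennreal_ereal)

@[fun_prop] lemma measurable_eexpNeg : Measurable eexpNeg := continuous_eexpNeg.measurable

@[simp] lemma eexpNeg_zero : eexpNeg 0 = 1 := by simp [eexpNeg, expNeg]

@[simp] lemma eexpNeg_top : eexpNeg ∞ = 0 := by simp [eexpNeg, expNeg]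

lemma expNeg_add (x y : ℝ≥0∞) : expNeg (x + y) = expNeg x * expNeg y := by
  by_cases hx : x = ∞
  · simp [expNeg, hx]
  by_cases hy : y = ∞
  · simp [expNeg, hy]
  simp only [expNeg, ENNReal.add_eq_top, hx, hy, or_self, if_false, ENNReal.toReal_add hx hy]
  rw [neg_add, Real.exp_add]

lemma eexpNeg_add (x y : ℝ≥0∞) : eexpNeg (x + y) = eexpNeg x * eexpNeg y := by
  rw [eexpNeg, expNeg_add, ENNReal.ofReal_mul (expNeg_nonneg x)]
  rfl

lemma eexpNeg_sum {ι : Type*} (s : Finset ι) (f : ι → ℝ≥0∞) :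
    eexpNeg (∑ i ∈ s, f i) = ∏ i ∈ s, eexpNeg (f i) := by
  classical
  induction s using Finset.induction_on with
  | empty => simp
  | insert a s ha ih => rw [Finset.sum_insert ha, Finset.prod_insert ha, eexpNeg_add, ih]

lemma antitone_eexpNeg : Antitone eexpNeg := by
  intro x y h
  simp only [eexpNeg_eq_exp, EReal.exp_le_exp_iff, EReal.neg_le_neg_iff]
  exact_mod_cast h

lemma eexpNeg_le_one (x : ℝ≥0∞) : eexpNeg x ≤ 1 := by
  simpa using antitone_eexpNeg (zero_le (a := x))

lemma toReal_eexpNeg (x : ℝ≥0∞) : (eexpNeg x).toReal = expNeg x :=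
  ENNReal.toReal_ofReal (expNeg_nonneg x)

lemma eexpNeg_ofReal {x : ℝ} (hx : 0 ≤ x) :
    eexpNeg (ENNReal.ofReal x) = ENNReal.ofReal (Real.exp (-x)) := by
  simp [eexpNeg, expNeg, hx]

lemma tendsto_eexpNeg_tsum (f : ℕ → ℝ≥0∞) :
    Tendsto (fun n => ∏ i ∈ Finset.range n, eexpNeg (f i)) atTop (𝓝 (eexpNeg (∑' i, f i))) := by
  simp_rw [← eexpNeg_sum]
  exact (continuous_eexpNeg.tendsto _).comp (ENNReal.tendsto_nat_tsum f)

/-- The inverse of `eexpNeg` on `[0, 1]`. -/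
noncomputable def negLog (v : ℝ≥0∞) : ℝ≥0∞ := (-(ENNReal.log v)).toENNReal

lemma measurable_negLog : Measurable negLog := by
  unfold negLog
  fun_prop

lemma eexpNeg_negLog {v : ℝ≥0∞} (hv : v ≤ 1) : eexpNeg (negLog v) = v := by
  rw [eexpNeg_eq_exp, negLog, EReal.coe_toENNReal (by simpa using hv), neg_neg, ENNReal.exp_log]

/-- The convergence of Laplace transforms along a convergent sequence. -/
lemma tendsto_lintegral_eexpNeg {Ω : Type*} [MeasurableSpace Ω] {P : Measure Ω}
    [IsFiniteMeasure P] {F : ℕ → Ω → ℝ≥0∞} {G : Ω → ℝ≥0∞} (hF : ∀ n, Measurable (F n))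
    (h : ∀ ω, Tendsto (fun n => F n ω) atTop (𝓝 (G ω))) :
    Tendsto (fun n => ∫⁻ ω, eexpNeg (F n ω) ∂P) atTop (𝓝 (∫⁻ ω, eexpNeg (G ω) ∂P)) := by
  refine tendsto_lintegral_of_dominated_convergence (fun _ => 1)
    (fun n => measurable_eexpNeg.comp (hF n)) (fun n => ae_of_all _ fun ω => eexpNeg_le_one _)
    (by simp) (ae_of_all _ fun ω => (continuous_eexpNeg.tendsto _).comp (h ω))

/-! ### The Laplace functional of a Poisson process -/

section Poisson

variable {Ω E : Type*} [MeasurableSpace Ω] [MeasurableSpace E] {P : Measure Ω}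
  {X : ℕ → Ω → E} {Λ : Measure E}

/-- A count is a sum of indicators over the points; this links the counts in the definition of the
process to sums of functions. -/
lemma toENNReal_pointCount {Ω E : Type*} (X : ℕ → Ω → E) (A : Set E) (ω : Ω) :
    (pointCount X A ω : ℝ≥0∞) = ∑' i, A.indicator 1 (X i ω) := by
  rw [pointCount, ← ENNReal.tsum_set_one]
  rw [tsum_subtype {i : ℕ | X i ω ∈ A} (fun _ => (1 : ℝ≥0∞))]
  rfl

lemma measurable_pointCount (hX : ∀ i, Measurable (X i)) {A : Set E} (hA : MeasurableSet A) :
    Measurable (pointCount X A) := by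
  have h : Measurable fun ω => (pointCount X A ω : ℝ≥0∞) := by
    simp_rw [toENNReal_pointCount]
    exact Measurable.tsum fun i => (measurable_one.indicator hA).comp (hX i)
  refine measurable_to_countable' fun n => ?_
  have : pointCount X A ⁻¹' {n} = (fun ω => (pointCount X A ω : ℝ≥0∞)) ⁻¹' {(n : ℝ≥0∞)} := by
    ext ω; simp
  rw [this]
  exact h (measurableSet_singleton _)

/-- The Laplace transform of a Poisson count. -/
lemma IsPoissonPointProcess.lintegral_eexpNeg_mul_pointCount [IsProbabilityMeasure P]
    (h : IsPoissonPointProcess P X Λ) {A : Set E} (hA : MeasurableSet A) (hΛ : Λ A ≠ ∞)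
    (y : ℝ≥0∞) :
    ∫⁻ ω, eexpNeg (y * (pointCount X A ω : ℝ≥0∞)) ∂P = eexpNeg ((1 - eexpNeg y) * Λ A) := by
  have hN := measurable_pointCount h.measurable hA
  set a : ℝ := (Λ A).toReal with ha
  have ha0 : 0 ≤ a := ENNReal.toReal_nonneg
  -- The Poisson generating function at x. It is used at x = e^{-y} for the transform, and at x = 1
  -- for the total mass.
  have hexp : ∀ x : ℝ, 0 ≤ x → ∑' n : ℕ, ENNReal.ofReal (Real.exp (-a) * a ^ n / n.factorial) *
      ENNReal.ofReal x ^ n = ENNReal.ofReal (Real.exp (-((1 - x) * a))) := by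
    intro x hx
    have hs : HasSum (fun n : ℕ => Real.exp (-a) * ((a * x) ^ n / n.factorial))
        (Real.exp (-a) * Real.exp (a * x)) :=
      ((Real.exp_eq_exp_ℝ ▸ NormedSpace.expSeries_div_hasSum_exp (a * x)).mul_left _)
    rw [show Real.exp (-((1 - x) * a)) = Real.exp (-a) * Real.exp (a * x) by
      rw [← Real.exp_add]; ring_nf, ← hs.tsum_eq,
      ENNReal.ofReal_tsum_of_nonneg (fun n => by positivity) hs.summable]
    congr 1
    ext n
    rw [← ENNReal.ofReal_pow hx, ← ENNReal.ofReal_mul (by positivity)]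
    congr 1
    rw [mul_pow]
    ring
  have hmap : ∀ n : ℕ, P.map (pointCount X A) {(n : ℕ∞)} =
      ENNReal.ofReal (Real.exp (-a) * a ^ n / n.factorial) := fun n => by
    rw [Measure.map_apply hN (measurableSet_singleton _)]
    exact h.poisson A hA hΛ n
  have hsplit : ∀ g : ℕ∞ → ℝ≥0∞, ∫⁻ ω, g (pointCount X A ω) ∂P =
      (∑' n : ℕ, ENNReal.ofReal (Real.exp (-a) * a ^ n / n.factorial) * g n) +
        P.map (pointCount X A) {⊤} * g ⊤ := by
    intro g
    rw [← lintegral_map (μ := P) (f := g) (measurable_from_top) hN, lintegral_countable',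
      ENNReal.tsum_eq_add_tsum_ite (⊤ : ℕ∞), add_comm, mul_comm (g ⊤)]
    congr 1
    rw [← tsum_subtype_eq_of_support_subset (s := range ((↑) : ℕ → ℕ∞)),
      ← Equiv.tsum_eq (Equiv.ofInjective _ (Nat.cast_injective (R := ℕ∞)))]
    · congr 1
      ext n
      simp [hmap, mul_comm]
    · intro n hn
      rcases eq_or_ne n ⊤ with rfl | h'
      · simp at hn
      · exact ⟨n.toNat, ENat.natCast_toNat h'⟩
  -- Only finite counts have a prescribed probability. These probabilities already sum to 1, so an
  -- infinite count is null.
  have htop : P.map (pointCount X A) {⊤} = 0 := by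
    have h1 := hsplit 1
    have h2 := hexp 1 zero_le_one
    simp only [ENNReal.ofReal_one, one_pow, sub_self, zero_mul, neg_zero, Real.exp_zero,
      mul_one] at h2
    simp only [Pi.one_apply, lintegral_one, measure_univ, mul_one] at h1
    have h3 : (1 : ℝ≥0∞) + 0 = 1 + P.map (pointCount X A) {⊤} := by
      rw [add_zero, ← h2, ← h1, h2]
    exact ((ENNReal.add_right_inj ENNReal.one_ne_top).1 h3).symm
  have hval : ∀ n : ℕ, eexpNeg (y * ((n : ℕ∞) : ℝ≥0∞)) = ENNReal.ofReal (expNeg y) ^ n := by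
    intro n
    have := eexpNeg_sum (Finset.range n) fun _ => y
    simp only [Finset.sum_const, Finset.prod_const, Finset.card_range, nsmul_eq_mul] at this
    rw [mul_comm]
    exact_mod_cast this
  rw [hsplit fun n => eexpNeg (y * (n : ℝ≥0∞)), htop, zero_mul, add_zero]
  simp_rw [hval]
  rw [hexp _ (expNeg_nonneg y)]
  have h1 : expNeg y ≤ 1 := by
    have := eexpNeg_le_one y
    rwa [eexpNeg, ENNReal.ofReal_le_one] at this
  rw [← eexpNeg_ofReal (mul_nonneg (by linarith) ha0), ENNReal.ofReal_mul (by linarith),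
    ENNReal.ofReal_sub _ (expNeg_nonneg y), ENNReal.ofReal_one, ENNReal.ofReal_toReal hΛ]
  rfl

/-- The Laplace functional of a Poisson point process at a simple function. -/
lemma IsPoissonPointProcess.laplace_simpleFunc [IsProbabilityMeasure P]
    (h : IsPoissonPointProcess P X Λ) (f : SimpleFunc E ℝ≥0∞)
    (hf : ∀ y ≠ 0, Λ (f ⁻¹' {y}) ≠ ∞) :
    ∫⁻ ω, eexpNeg (∑' i, f (X i ω)) ∂P = eexpNeg (∫⁻ x, (1 - eexpNeg (f x)) ∂Λ) := by
  classical
  -- The level set of 0 may have infinite intensity, but it contributes to neither side and is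
  -- dropped.
  set S := f.range.erase 0 with hS
  let φ : Fin S.card ≃ S := S.equivFin.symm
  have hsum : ∀ ω, ∑' i, f (X i ω) =
      ∑ j, (φ j : ℝ≥0∞) * (pointCount X (f ⁻¹' {(φ j : ℝ≥0∞)}) ω : ℝ≥0∞) := by
    intro ω
    simp_rw [toENNReal_pointCount, ← ENNReal.tsum_mul_left]
    rw [← Summable.tsum_finsetSum fun _ _ => ENNReal.summable]
    congr 1
    ext i
    rw [Equiv.sum_comp φ fun y : S =>
      (y : ℝ≥0∞) * (f ⁻¹' {(y : ℝ≥0∞)}).indicator 1 (X i ω), Finset.sum_coe_sort S fun y =>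
      y * (f ⁻¹' {y}).indicator 1 (X i ω)]
    by_cases h0 : f (X i ω) = 0
    · rw [h0, eq_comm]
      refine Finset.sum_eq_zero fun y hy => ?_
      simp [indicator, h0, (Finset.ne_of_mem_erase hy).symm]
    · rw [Finset.sum_eq_single (f (X i ω))]
      · simp
      · intro y _ hy
        simp [indicator, hy.symm]
      · intro hn
        simp [hS, h0] at hn
  have hint : ∫⁻ x, (1 - eexpNeg (f x)) ∂Λ =
      ∑ j, (1 - eexpNeg (φ j)) * Λ (f ⁻¹' {(φ j : ℝ≥0∞)}) := by
    have h1 : ∀ x, 1 - eexpNeg (f x) = (f.map fun y => 1 - eexpNeg y) x := fun _ => rfl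
    simp_rw [h1]
    rw [SimpleFunc.lintegral_eq_lintegral, SimpleFunc.map_lintegral,
      Equiv.sum_comp φ fun y : S => (1 - eexpNeg y) * Λ (f ⁻¹' {(y : ℝ≥0∞)}),
      Finset.sum_coe_sort S fun y => (1 - eexpNeg y) * Λ (f ⁻¹' {y})]
    refine (Finset.sum_subset (Finset.erase_subset _ _) fun y _ hy => ?_).symm
    have : y = 0 := by
      by_contra h0
      simp_all
    simp [this]
  have hind := h.indep S.card (fun j => f ⁻¹' {(φ j : ℝ≥0∞)})
    (fun j => f.measurableSet_preimage _) (fun j l hjl => by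
      refine Disjoint.preimage _ ?_
      simpa [Subtype.val_inj] using hjl)
  have hm : ∀ j, Measurable (pointCount X (f ⁻¹' {(φ j : ℝ≥0∞)})) := fun j =>
    measurable_pointCount h.measurable (f.measurableSet_preimage _)
  have hg : ∀ y : ℝ≥0∞, Measurable fun n : ℕ∞ => eexpNeg (y * (n : ℝ≥0∞)) :=
    fun y => measurable_from_top
  simp_rw [hsum, hint, eexpNeg_sum]
  rw [lintegral_prod_eq_prod_lintegral_of_indepFun Finset.univ
    (fun j ω => eexpNeg ((φ j : ℝ≥0∞) * (pointCount X (f ⁻¹' {(φ j : ℝ≥0∞)}) ω : ℝ≥0∞)))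
    (hind.comp (fun j (n : ℕ∞) => eexpNeg ((φ j : ℝ≥0∞) * (n : ℝ≥0∞))) fun j => hg _)
    fun j => (hg _).comp (hm j)]
  refine Finset.prod_congr rfl fun j _ => ?_
  exact h.lintegral_eexpNeg_mul_pointCount (f.measurableSet_preimage _)
    (hf _ (Finset.ne_of_mem_erase (φ j).2)) _

/-- The Laplace functional of a Poisson point process. -/
theorem IsPoissonPointProcess.laplace [IsProbabilityMeasure P] [SigmaFinite Λ]
    (h : IsPoissonPointProcess P X Λ) {f : E → ℝ≥0∞} (hf : Measurable f) :
    ∫⁻ ω, eexpNeg (∑' i, f (X i ω)) ∂P = eexpNeg (∫⁻ x, (1 - eexpNeg (f x)) ∂Λ) := by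
  -- Cutting off to the spanning sets gives every nonzero level set finite intensity.
  let g : ℕ → SimpleFunc E ℝ≥0∞ := fun n =>
    (SimpleFunc.eapprox f n).restrict (spanningSets Λ n)
  have hgapp : ∀ n x, g n x = (spanningSets Λ n).indicator (SimpleFunc.eapprox f n) x :=
    fun n x => SimpleFunc.restrict_apply _ (measurableSet_spanningSets Λ n) x
  have hmono : ∀ x, Monotone fun n => g n x := by
    intro x n m hnm
    simp only [hgapp]
    refine (indicator_le_indicator (SimpleFunc.monotone_eapprox f hnm x)).trans ?_
    exact indicator_le_indicator_of_subset (monotone_spanningSets Λ hnm) (fun _ => zero_le) x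
  have hlim : ∀ x, Tendsto (fun n => g n x) atTop (𝓝 (f x)) := by
    intro x
    refine (SimpleFunc.tendsto_eapprox hf x).congr' ?_
    filter_upwards [eventually_ge_atTop (spanningSetsIndex Λ x)] with n hn
    rw [hgapp, indicator_of_mem (mem_spanningSets_of_index_le Λ x hn)]
  have hfin : ∀ n, ∀ y ≠ 0, Λ (g n ⁻¹' {y}) ≠ ∞ := by
    intro n y hy
    refine ((measure_mono fun x hx => ?_).trans_lt (measure_spanningSets_lt_top Λ n)).ne
    by_contra hx'
    simp [hgapp, hx'] at hx
    exact hy hx.symm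
  have h1 : Tendsto (fun n => ∫⁻ ω, eexpNeg (∑' i, g n (X i ω)) ∂P) atTop
      (𝓝 (∫⁻ ω, eexpNeg (∑' i, f (X i ω)) ∂P)) := by
    refine tendsto_lintegral_eexpNeg
      (fun n => Measurable.tsum fun i => (g n).measurable.comp (h.measurable i)) ?_
    intro ω
    -- For fixed ω the sum over points is an integral against counting measure, so monotone
    -- convergence applies.
    have := lintegral_tendsto_of_tendsto_of_monotone (μ := Measure.count)
      (f := fun n i => g n (X i ω)) (F := fun i => f (X i ω))
      (fun n => measurable_from_top.aemeasurable)
      (ae_of_all _ fun i => hmono _) (ae_of_all _ fun i => hlim _)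
    simpa only [lintegral_count] using this
  have h2 : Tendsto (fun n => eexpNeg (∫⁻ x, (1 - eexpNeg (g n x)) ∂Λ)) atTop
      (𝓝 (eexpNeg (∫⁻ x, (1 - eexpNeg (f x)) ∂Λ))) := by
    refine (continuous_eexpNeg.tendsto _).comp
      (lintegral_tendsto_of_tendsto_of_monotone (fun n => ?_) (ae_of_all _ fun x => ?_)
        (ae_of_all _ fun x => ?_))
    · exact (measurable_const.sub (measurable_eexpNeg.comp (g n).measurable)).aemeasurable
    · exact fun n m hnm => tsub_le_tsub_left (antitone_eexpNeg (hmono x hnm)) _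
    · exact ENNReal.Tendsto.sub tendsto_const_nhds
        ((continuous_eexpNeg.tendsto _).comp (hlim x)) (Or.inl ENNReal.one_ne_top)
  refine tendsto_nhds_unique (h1.congr fun n => ?_) h2
  exact h.laplace_simpleFunc (g n) (hfin n)

end Poisson

/-! ### Dyadic approximation from above -/

/-- The dyadic number of level `n` that follows `r`. -/
noncomputable def dyadicAbove (n : ℕ) (r : ℝ) : ℝ := (⌊2 ^ n * r⌋₊ + 1) / 2 ^ n

/-- The inequality is strict even at dyadic r, because the floor plus one is used. Hence each cell
lies strictly below its upper endpoint. -/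
lemma lt_dyadicAbove (n : ℕ) (r : ℝ) : r < dyadicAbove n r := by
  rw [dyadicAbove, lt_div_iff₀ (by positivity), mul_comm]
  exact Nat.lt_floor_add_one _

lemma dyadicAbove_le (n : ℕ) {r : ℝ} (hr : 0 ≤ r) : dyadicAbove n r ≤ r + (1 / 2) ^ n := by
  rw [dyadicAbove, div_le_iff₀ (by positivity), add_mul, ← mul_pow]
  have := Nat.floor_le (show 0 ≤ 2 ^ n * r by positivity)
  norm_num
  linarith

lemma antitone_dyadicAbove {r : ℝ} (hr : 0 ≤ r) : Antitone fun n => dyadicAbove n r := by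
  refine antitone_nat_of_succ_le fun n => ?_
  have h1 : ⌊2 ^ (n + 1) * r⌋₊ < 2 * (⌊2 ^ n * r⌋₊ + 1) := by
    rw [Nat.floor_lt (by positivity)]
    push_cast
    have := Nat.lt_floor_add_one (2 ^ n * r)
    rw [pow_succ]
    linarith
  have h2 : (⌊2 ^ (n + 1) * r⌋₊ : ℝ) + 1 ≤ 2 * (⌊2 ^ n * r⌋₊ + 1) := by exact_mod_cast h1
  rw [dyadicAbove, dyadicAbove, div_le_div_iff₀ (by positivity) (by positivity)]
  calc ((⌊2 ^ (n + 1) * r⌋₊ : ℝ) + 1) * 2 ^ n ≤ 2 * (⌊2 ^ n * r⌋₊ + 1) * 2 ^ n := by gcongr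
    _ = (⌊2 ^ n * r⌋₊ + 1) * 2 ^ (n + 1) := by ring

lemma tendsto_dyadicAbove {r : ℝ} (hr : 0 ≤ r) :
    Tendsto (fun n => dyadicAbove n r) atTop (𝓝 r) := by
  refine tendsto_of_tendsto_of_tendsto_of_le_of_le tendsto_const_nhds ?_
    (fun n => (lt_dyadicAbove n r).le) fun n => dyadicAbove_le n hr
  simpa using tendsto_const_nhds.add
    (tendsto_pow_atTop_nhds_zero_of_lt_one (r := (1 / 2 : ℝ)) (by norm_num) (by norm_num))

/-! ### The nearest point and the process beyond it -/

section Norm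

variable {Ω E : Type*} [MeasurableSpace Ω] {P : Measure Ω} {X : ℕ → Ω → E}
  [NormedAddCommGroup E] [MeasurableSpace E] [BorelSpace E] {Λ : Measure E}

/-- Integrals over the exterior of a closed ball are right continuous in the radius. -/
lemma tendsto_setLIntegral_norm_gt {α : Type*} [MeasurableSpace α] {ν : Measure α} {N : α → ℝ}
    (hN : Measurable N) (g : α → ℝ≥0∞) {t : ℕ → ℝ} {r : ℝ} (hanti : Antitone t)
    (hgt : ∀ n, r < t n) (ht : Tendsto t atTop (𝓝 r)) :
    Tendsto (fun n => ∫⁻ x in {x | t n < N x}, g x ∂ν) atTop (𝓝 (∫⁻ x in {x | r < N x}, g x ∂ν)) := by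
  have hmeas : ∀ a, MeasurableSet {x | a < N x} := fun a => measurableSet_lt measurable_const hN
  have hU : {x | r < N x} = ⋃ n, {x | t n < N x} := by
    ext x
    simp only [mem_ofPred_eq, mem_iUnion]
    refine ⟨fun hx => (ht.eventually_lt_const hx).exists, fun ⟨n, hn⟩ => (hgt n).trans hn⟩
  have hmono : Monotone fun n => {x | t n < N x} := fun n m hnm x hx =>
    lt_of_le_of_lt (hanti hnm) hx
  -- Strict inequality makes the exteriors increase to their union, so this is continuity from below
  -- of the measure with density g.
  have := tendsto_measure_iUnion_atTop (μ := ν.withDensity g) hmono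
  simp only [Function.comp_def, ← hU, withDensity_apply _ (hmeas _)] at this
  exact this

/-- The distance from the origin to the nearest point. -/
noncomputable def nearestDist (X : ℕ → Ω → E) (ω : Ω) : ℝ := ⨅ i, ‖X i ω‖

lemma bddBelow_norm {Ω E : Type*} [NormedAddCommGroup E] {X : ℕ → Ω → E} (ω : Ω) : BddBelow (range fun i => ‖X i ω‖) :=
  ⟨0, by rintro _ ⟨i, rfl⟩; positivity⟩

lemma nearestDist_nonneg {Ω E : Type*} [NormedAddCommGroup E] {X : ℕ → Ω → E} (ω : Ω) : 0 ≤ nearestDist X ω := Real.iInf_nonneg fun _ => norm_nonneg _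

lemma le_nearestDist_iff {Ω E : Type*} [NormedAddCommGroup E] {X : ℕ → Ω → E} {a : ℝ} {ω : Ω} : a ≤ nearestDist X ω ↔ ∀ i, a ≤ ‖X i ω‖ :=
  le_ciInf_iff (bddBelow_norm ω)

lemma measurable_nearestDist (hX : ∀ i, Measurable (X i)) : Measurable (nearestDist X) :=
  Measurable.iInf fun i => (hX i).norm

/-- The sum of `f` over the points at distance more than `t`. -/
noncomputable def sumBeyond (X : ℕ → Ω → E) (f : E → ℝ≥0∞) (t : ℝ) (ω : Ω) : ℝ≥0∞ :=
  ∑' i, {x : E | t < ‖x‖}.indicator f (X i ω)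

lemma measurable_sumBeyond (hX : ∀ i, Measurable (X i)) {f : E → ℝ≥0∞} (hf : Measurable f)
    {t : Ω → ℝ} (ht : Measurable t) : Measurable fun ω => sumBeyond X f (t ω) ω := by
  refine Measurable.tsum fun i => ?_
  have : (fun ω => {x : E | t ω < ‖x‖}.indicator f (X i ω)) =
      {ω | t ω < ‖X i ω‖}.indicator fun ω => f (X i ω) := by
    ext ω; simp [indicator]
  rw [this]
  exact (hf.comp (hX i)).indicator (measurableSet_lt ht (hX i).norm)

/-- In this form, right continuity in t is an instance of the statement for integrals over
exteriors. -/
lemma sumBeyond_eq_setLIntegral {Ω E : Type*} [NormedAddCommGroup E] {X : ℕ → Ω → E} {f : E → ℝ≥0∞} (t : ℝ) (ω : Ω) :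
    sumBeyond X f t ω = ∫⁻ i in {i | t < ‖X i ω‖}, f (X i ω) ∂Measure.count := by
  rw [← lintegral_indicator (DiscreteMeasurableSpace.forall_measurableSet _), lintegral_count]
  rfl

/-- The contribution of the exterior of the ball of radius `t` to a Laplace functional. -/
noncomputable def laplaceBeyond (Λ : Measure E) (f : E → ℝ≥0∞) (t : ℝ) : ℝ≥0∞ :=
  eexpNeg (∫⁻ x in {x | t < ‖x‖}, (1 - eexpNeg (f x)) ∂Λ)

variable [IsProbabilityMeasure P] [SigmaFinite Λ]

/-- The contact distribution of a Poisson point process, jointly with a Laplace functional of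
the points outside of a larger ball. -/
lemma IsPoissonPointProcess.setLIntegral_le_nearestDist (h : IsPoissonPointProcess P X Λ)
    {f : E → ℝ≥0∞} (hf : Measurable f) {a t : ℝ} (hat : a ≤ t) :
    ∫⁻ ω in {ω | a ≤ nearestDist X ω}, eexpNeg (sumBeyond X f t ω) ∂P =
      eexpNeg (Λ (Metric.ball 0 a)) * laplaceBeyond Λ f t := by
  have hball : MeasurableSet (Metric.ball (0 : E) a) := measurableSet_ball
  have hout : MeasurableSet {x : E | t < ‖x‖} := measurableSet_lt measurable_const measurable_norm
  have hdisj : Disjoint (Metric.ball (0 : E) a) {x : E | t < ‖x‖} := by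
    rw [Set.disjoint_left]
    intro x hx hx'
    rw [mem_ball_zero_iff] at hx
    exact absurd hx (not_lt.2 (hat.trans (le_of_lt hx')))
  -- The value ∞ on the ball encodes the event that no point lies in it; disjointness of the two
  -- regions splits the exponent.
  let g : E → ℝ≥0∞ := (Metric.ball (0 : E) a).indicator (fun _ => ∞) + {x : E | t < ‖x‖}.indicator f
  have hg : Measurable g := (measurable_const.indicator hball).add (hf.indicator hout)
  have hset : MeasurableSet {ω | a ≤ nearestDist X ω} :=
    measurableSet_le measurable_const (measurable_nearestDist h.measurable)
  have h1 := h.laplace hg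
  have hL : ∀ ω, eexpNeg (∑' i, g (X i ω)) =
      {ω | a ≤ nearestDist X ω}.indicator (fun ω => eexpNeg (sumBeyond X f t ω)) ω := by
    intro ω
    simp only [g, Pi.add_apply]
    rw [ENNReal.tsum_add, eexpNeg_add]
    by_cases hω : a ≤ nearestDist X ω
    · rw [indicator_of_mem (by exact hω)]
      have : ∀ i, (Metric.ball (0 : E) a).indicator (fun _ => ∞) (X i ω) = 0 := fun i =>
        indicator_of_notMem (by simpa using le_nearestDist_iff.1 hω i) _
      simp [this, sumBeyond]
    · rw [indicator_of_notMem (by exact hω)]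
      rw [le_nearestDist_iff, not_forall] at hω
      obtain ⟨i, hi⟩ := hω
      rw [ENNReal.tsum_eq_top_of_eq_top ⟨i, indicator_of_mem (by simpa using hi) _⟩,
        eexpNeg_top, zero_mul]
  have hR : ∀ x, 1 - eexpNeg (g x) = (Metric.ball (0 : E) a).indicator 1 x +
      {x : E | t < ‖x‖}.indicator (fun x => 1 - eexpNeg (f x)) x := by
    intro x
    simp only [g, Pi.add_apply]
    by_cases hx : x ∈ Metric.ball (0 : E) a
    · have hx' := Set.disjoint_left.1 hdisj hx
      simp [indicator_of_mem hx, indicator_of_notMem hx']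
    · by_cases hx' : x ∈ {x : E | t < ‖x‖}
      · simp [indicator_of_notMem hx, indicator_of_mem hx']
      · simp [indicator_of_notMem hx, indicator_of_notMem hx']
  simp_rw [hL, hR] at h1
  rw [lintegral_indicator hset, lintegral_add_left (measurable_one.indicator hball),
    lintegral_indicator_one hball, lintegral_indicator hout, eexpNeg_add] at h1
  exact h1

/-- The contact distribution of a Poisson point process. -/
lemma IsPoissonPointProcess.measure_le_nearestDist (h : IsPoissonPointProcess P X Λ) (a : ℝ) :
    P {ω | a ≤ nearestDist X ω} = eexpNeg (Λ (Metric.ball 0 a)) := by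
  have := h.setLIntegral_le_nearestDist (f := 0) measurable_zero le_rfl (a := a)
  simpa [sumBeyond, laplaceBeyond] using this

/-- The distance of the nearest point, as long as it is less than `t`, is independent of the
Laplace functional of the points beyond `t`. -/
lemma IsPoissonPointProcess.setLIntegral_nearestDist_of_subset (h : IsPoissonPointProcess P X Λ)
    {f : E → ℝ≥0∞} (hf : Measurable f) {t : ℝ} {B : Set ℝ} (hB : MeasurableSet B)
    (hBt : B ⊆ Iio t) :
    ∫⁻ ω in nearestDist X ⁻¹' B, eexpNeg (sumBeyond X f t ω) ∂P =
      ∫⁻ _ in nearestDist X ⁻¹' B, laplaceBeyond Λ f t ∂P := by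
  have hR := measurable_nearestDist h.measurable
  have hM : Measurable fun ω => min (nearestDist X ω) t := hR.min measurable_const
  have hV : Measurable fun ω => eexpNeg (sumBeyond X f t ω) :=
    measurable_eexpNeg.comp (measurable_sumBeyond h.measurable hf measurable_const)
  set μ₁ := (P.withDensity fun ω => eexpNeg (sumBeyond X f t ω)).map
    fun ω => min (nearestDist X ω) t
  set μ₂ := laplaceBeyond Λ f t • P.map fun ω => min (nearestDist X ω) t
  have hfin : IsFiniteMeasure (P.withDensity fun ω => eexpNeg (sumBeyond X f t ω)) := by
    refine isFiniteMeasure_withDensity ((lintegral_mono fun ω => eexpNeg_le_one _).trans_lt ?_).ne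
    simp
  -- Truncating at t lets closed half-lines determine the measures: for a ≤ t the truncation does
  -- not affect the event, and for a > t the event is empty. As B lies below t, the truncation is
  -- invisible on B.
  have hμ : μ₁ = μ₂ := by
    refine Measure.ext_of_Ici _ _ fun a => ?_
    simp only [μ₁, μ₂, Measure.smul_apply, smul_eq_mul]
    rw [Measure.map_apply hM measurableSet_Ici, Measure.map_apply hM measurableSet_Ici,
      withDensity_apply _ (hM measurableSet_Ici)]
    by_cases hat : a ≤ t
    · have : (fun ω => min (nearestDist X ω) t) ⁻¹' Ici a = {ω | a ≤ nearestDist X ω} := by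
        ext ω; simp [hat]
      rw [this, h.setLIntegral_le_nearestDist hf hat, h.measure_le_nearestDist, mul_comm]
    · have : (fun ω => min (nearestDist X ω) t) ⁻¹' Ici a = ∅ := by
        ext ω; simp [hat]
      simp [this]
  have hpre : (fun ω => min (nearestDist X ω) t) ⁻¹' B = nearestDist X ⁻¹' B := by
    ext ω
    simp only [mem_preimage]
    rcases lt_or_ge (nearestDist X ω) t with hlt | hge
    · rw [min_eq_left hlt.le]
    · rw [min_eq_right hge]
      exact ⟨fun hB' => absurd (hBt hB') (lt_irrefl t), fun hB' => absurd (hBt hB') (not_lt.2 hge)⟩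
  have := congrArg (fun μ => μ B) hμ
  simp only [μ₁, μ₂, Measure.smul_apply, smul_eq_mul] at this
  rw [Measure.map_apply hM hB, Measure.map_apply hM hB, hpre,
    withDensity_apply _ (hR hB)] at this
  rw [this, setLIntegral_const]

/-- Given the distance of the nearest point, the points beyond that distance still have the
Laplace functional of a Poisson point process. -/
theorem IsPoissonPointProcess.setLIntegral_sumBeyond_nearestDist
    (h : IsPoissonPointProcess P X Λ) {f : E → ℝ≥0∞} (hf : Measurable f) {B : Set ℝ}
    (hB : MeasurableSet B) :
    ∫⁻ ω in nearestDist X ⁻¹' B, eexpNeg (sumBeyond X f (nearestDist X ω) ω) ∂P =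
      ∫⁻ ω in nearestDist X ⁻¹' B, laplaceBeyond Λ f (nearestDist X ω) ∂P := by
  have hR := measurable_nearestDist h.measurable
  have hρ : ∀ n, Measurable (dyadicAbove n) := fun n => by
    unfold dyadicAbove
    fun_prop
  have hstep : ∀ n, ∫⁻ ω in nearestDist X ⁻¹' B,
        eexpNeg (sumBeyond X f (dyadicAbove n (nearestDist X ω)) ω) ∂P =
      ∫⁻ ω in nearestDist X ⁻¹' B, laplaceBeyond Λ f (dyadicAbove n (nearestDist X ω)) ∂P := by
    intro n
    -- On each cell the dyadic radius is constant, so the result for deterministic t applies.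
    let S : ℕ → Set ℝ := fun k => B ∩ {r | ⌊2 ^ n * r⌋₊ = k}
    have hS : ∀ k, MeasurableSet (S k) := fun k =>
      hB.inter ((Nat.measurable_floor.comp (measurable_const.mul measurable_id))
        (measurableSet_singleton k))
    have hU : nearestDist X ⁻¹' B = ⋃ k, nearestDist X ⁻¹' (S k) := by
      ext ω; simp [S]
    have hd : Pairwise (Function.onFun Disjoint fun k => nearestDist X ⁻¹' (S k)) := by
      intro k l hkl
      refine Disjoint.preimage _ (Set.disjoint_left.2 fun r hr hr' => hkl ?_)
      exact hr.2.symm.trans hr'.2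
    rw [hU, lintegral_iUnion (fun k => hR (hS k)) hd, lintegral_iUnion (fun k => hR (hS k)) hd]
    congr 1
    ext k
    have hval : ∀ ω ∈ nearestDist X ⁻¹' (S k),
        dyadicAbove n (nearestDist X ω) = ((k : ℝ) + 1) / 2 ^ n := by
      intro ω hω
      have : ⌊2 ^ n * nearestDist X ω⌋₊ = k := hω.2
      rw [dyadicAbove, this]
    refine (setLIntegral_congr_fun (hR (hS k)) fun ω hω => by
      simp only [hval ω hω]).trans ((h.setLIntegral_nearestDist_of_subset hf (hS k)
        (t := ((k : ℝ) + 1) / 2 ^ n) fun r hr => ?_).trans (setLIntegral_congr_fun (hR (hS k))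
          fun ω hω => by simp only [hval ω hω]).symm)
    have h1 : ⌊2 ^ n * r⌋₊ = k := hr.2
    have h2 := lt_dyadicAbove n r
    rwa [dyadicAbove, h1] at h2
  have h1 : Tendsto (fun n => ∫⁻ ω in nearestDist X ⁻¹' B,
      eexpNeg (sumBeyond X f (dyadicAbove n (nearestDist X ω)) ω) ∂P) atTop
      (𝓝 (∫⁻ ω in nearestDist X ⁻¹' B, eexpNeg (sumBeyond X f (nearestDist X ω) ω) ∂P)) := by
    refine tendsto_lintegral_eexpNeg
      (fun n => measurable_sumBeyond h.measurable hf ((hρ n).comp hR)) fun ω => ?_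
    simp_rw [sumBeyond_eq_setLIntegral]
    exact tendsto_setLIntegral_norm_gt measurable_from_top _
      (antitone_dyadicAbove (nearestDist_nonneg ω))
      (fun n => lt_dyadicAbove n _) (tendsto_dyadicAbove (nearestDist_nonneg ω))
  have hmI : Measurable fun t : ℝ => ∫⁻ x in {x | t < ‖x‖}, (1 - eexpNeg (f x)) ∂Λ :=
    Antitone.measurable fun a b hab => lintegral_mono_set fun x hx => lt_of_le_of_lt hab hx
  have h2 : Tendsto (fun n => ∫⁻ ω in nearestDist X ⁻¹' B,
      laplaceBeyond Λ f (dyadicAbove n (nearestDist X ω)) ∂P) atTop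
      (𝓝 (∫⁻ ω in nearestDist X ⁻¹' B, laplaceBeyond Λ f (nearestDist X ω) ∂P)) := by
    refine tendsto_lintegral_eexpNeg (fun n => hmI.comp ((hρ n).comp hR)) fun ω => ?_
    exact tendsto_setLIntegral_norm_gt measurable_norm _
      (antitone_dyadicAbove (nearestDist_nonneg ω))
      (fun n => lt_dyadicAbove n _) (tendsto_dyadicAbove (nearestDist_nonneg ω))
  exact tendsto_nhds_unique (h1.congr hstep) h2

end Norm

/-! ### Integrating out independent marks -/

section Marks

variable {Ω E M : Type*} [MeasurableSpace Ω] [MeasurableSpace M] {P : Measure Ω}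
  {X : ℕ → Ω → E} {Y : ℕ → Ω → M}

/-- The Laplace transform of a sum of functions of independent marks. -/
lemma lintegral_eexpNeg_tsum_of_iIndepFun [IsProbabilityMeasure P] (hY : ∀ i, Measurable (Y i))
    (hind : iIndepFun Y P) {G : ℕ → M → ℝ≥0∞} (hG : ∀ i, Measurable (G i)) :
    ∫⁻ ω, eexpNeg (∑' i, G i (Y i ω)) ∂P =
      eexpNeg (∑' i, negLog (∫⁻ m, eexpNeg (G i m) ∂(P.map (Y i)))) := by
  have hGY : ∀ i, Measurable fun ω => G i (Y i ω) := fun i => (hG i).comp (hY i)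
  have hle : ∀ i, ∫⁻ m, eexpNeg (G i m) ∂(P.map (Y i)) ≤ 1 := fun i => by
    have := Measure.isProbabilityMeasure_map (μ := P) (hY i).aemeasurable
    exact (lintegral_mono fun m => eexpNeg_le_one _).trans (by simp)
  have h1 : Tendsto (fun n => ∫⁻ ω, eexpNeg (∑ i ∈ Finset.range n, G i (Y i ω)) ∂P) atTop
      (𝓝 (∫⁻ ω, eexpNeg (∑' i, G i (Y i ω)) ∂P)) :=
    tendsto_lintegral_eexpNeg (fun n => Finset.measurable_sum _ fun i _ => hGY i)
      fun ω => ENNReal.tendsto_nat_tsum _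
  refine tendsto_nhds_unique h1 ((tendsto_eexpNeg_tsum _).congr fun n => ?_)
  simp_rw [eexpNeg_sum]
  rw [lintegral_prod_eq_prod_lintegral_of_indepFun (Finset.range n)
    (fun i ω => eexpNeg (G i (Y i ω)))
    (hind.comp (fun i m => eexpNeg (G i m)) fun i => measurable_eexpNeg.comp (hG i))
    fun i => measurable_eexpNeg.comp (hGY i)]
  refine Finset.prod_congr rfl fun i _ => ?_
  rw [eexpNeg_negLog (hle i), lintegral_map (by fun_prop) (hY i)]

variable [NormedAddCommGroup E] [MeasurableSpace E] [BorelSpace E] {Λ : Measure E}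

/-- The Laplace transform, given the distance of the nearest point, of the sum over the farther
points of an independently marked Poisson point process. -/
theorem IsPoissonPointProcess.setLIntegral_marked [IsProbabilityMeasure P] [SigmaFinite Λ]
    (h : IsPoissonPointProcess P X Λ) (hY : ∀ i, Measurable (Y i)) (hind : iIndepFun Y P)
    {μ : Measure M} [IsProbabilityMeasure μ] (hlaw : ∀ i, P.map (Y i) = μ)
    (hXY : IndepFun (fun ω i => X i ω) (fun ω i => Y i ω) P) {F : E × M → ℝ≥0∞}
    (hF : Measurable F) {B : Set ℝ} (hB : MeasurableSet B) :
    ∫⁻ ω in nearestDist X ⁻¹' B, eexpNeg (∑' i, {x : E | nearestDist X ω < ‖x‖}.indicator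
        (fun x => F (x, Y i ω)) (X i ω)) ∂P =
      ∫⁻ ω in nearestDist X ⁻¹' B, eexpNeg (∫⁻ x in {x | nearestDist X ω < ‖x‖},
        (1 - ∫⁻ m, eexpNeg (F (x, m)) ∂μ) ∂Λ) ∂P := by
  let R : (ℕ → E) → ℝ := fun x => ⨅ i, ‖x i‖
  have hR : Measurable R := Measurable.iInf fun i => (measurable_pi_apply i).norm
  let H : (ℕ → E) × (ℕ → M) → ℝ≥0∞ := fun z => eexpNeg (∑' i,
    {x : E | R z.1 < ‖x‖}.indicator (fun x => F (x, z.2 i)) (z.1 i))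
  have hH : Measurable H := by
    refine measurable_eexpNeg.comp (Measurable.tsum fun i => ?_)
    have hX1 : Measurable fun z : (ℕ → E) × (ℕ → M) => z.1 i :=
      (measurable_pi_apply i).comp measurable_fst
    have hY1 : Measurable fun z : (ℕ → E) × (ℕ → M) => z.2 i :=
      (measurable_pi_apply i).comp measurable_snd
    have : (fun z : (ℕ → E) × (ℕ → M) =>
        {x : E | R z.1 < ‖x‖}.indicator (fun x => F (x, z.2 i)) (z.1 i)) =
        {z | R z.1 < ‖z.1 i‖}.indicator fun z => F (z.1 i, z.2 i) := by
      ext z; simp [indicator]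
    rw [this]
    exact (hF.comp (hX1.prodMk hY1)).indicator (measurableSet_lt (hR.comp measurable_fst) hX1.norm)
  have hXm : Measurable fun ω i => X i ω := measurable_pi_lambda _ h.measurable
  have hYm : Measurable fun ω i => Y i ω := measurable_pi_lambda _ hY
  have hRX : Measurable (nearestDist X) := measurable_nearestDist h.measurable
  -- The deterministic function whose e^{-f} is the mark average of e^{-F}; it reduces the marked
  -- process to the unmarked one.
  let f : E → ℝ≥0∞ := fun x => negLog (∫⁻ m, eexpNeg (F (x, m)) ∂μ)
  have hf : Measurable f :=
    measurable_negLog.comp (measurable_eexpNeg.comp hF).lintegral_prod_right'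
  have hef : ∀ x, eexpNeg (f x) = ∫⁻ m, eexpNeg (F (x, m)) ∂μ := fun x =>
    eexpNeg_negLog ((lintegral_mono fun m => eexpNeg_le_one _).trans (by simp))
  have hinner : ∀ x : ℕ → E, ∫⁻ y, H (x, y) ∂(P.map fun ω i => Y i ω) =
      eexpNeg (∑' i, {z : E | R x < ‖z‖}.indicator f (x i)) := by
    intro x
    rw [lintegral_map (by fun_prop) hYm]
    have hG : ∀ i, Measurable fun m =>
        {z : E | R x < ‖z‖}.indicator (fun z => F (z, m)) (x i) := by
      intro i
      by_cases hx : R x < ‖x i‖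
      · have : (fun m => {z : E | R x < ‖z‖}.indicator (fun z => F (z, m)) (x i)) =
            fun m => F (x i, m) := funext fun m => indicator_of_mem (by exact hx) _
        rw [this]
        fun_prop
      · simp [indicator, hx]
    refine (lintegral_eexpNeg_tsum_of_iIndepFun hY hind hG).trans ?_
    congr 2
    ext i
    rw [hlaw]
    by_cases hx : R x < ‖x i‖
    · simp [indicator, hx, f]
    -- A point not beyond R contributes 0, whose transform is 1, and -log 1 = 0.
    · simp [indicator, hx, negLog]
  calc ∫⁻ ω in nearestDist X ⁻¹' B, eexpNeg (∑' i, {x : E | nearestDist X ω < ‖x‖}.indicator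
        (fun x => F (x, Y i ω)) (X i ω)) ∂P
      = ∫⁻ ω, (R ⁻¹' B).indicator 1 (fun i => X i ω) *
          H ((fun i => X i ω), fun i => Y i ω) ∂P := by
        rw [← lintegral_indicator (hRX hB)]
        congr 1
        ext ω
        by_cases hω : nearestDist X ω ∈ B
        · rw [indicator_of_mem (by exact hω), indicator_of_mem (by exact hω), Pi.one_apply, one_mul]
          rfl
        · rw [indicator_of_notMem (by exact hω), indicator_of_notMem (by exact hω), zero_mul]
    _ = ∫⁻ z, (R ⁻¹' B).indicator 1 z.1 * H z
          ∂((P.map fun ω i => X i ω).prod (P.map fun ω i => Y i ω)) := by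
        rw [← (indepFun_iff_map_prod_eq_prod_map_map hXm.aemeasurable hYm.aemeasurable).1 hXY,
          lintegral_map _ (hXm.prodMk hYm)]
        exact ((measurable_one.indicator (hR hB)).comp measurable_fst).mul hH
    _ = ∫⁻ x, (R ⁻¹' B).indicator 1 x * eexpNeg (∑' i, {z : E | R x < ‖z‖}.indicator f (x i))
          ∂(P.map fun ω i => X i ω) := by
        have := Measure.isProbabilityMeasure_map (μ := P) hYm.aemeasurable
        have hI : Measurable ((R ⁻¹' B).indicator (1 : (ℕ → E) → ℝ≥0∞)) :=
          measurable_one.indicator (hR hB)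
        rw [lintegral_prod _ (by fun_prop)]
        refine lintegral_congr fun x => ?_
        dsimp only
        rw [lintegral_const_mul _ (by fun_prop), hinner]
    _ = ∫⁻ ω in nearestDist X ⁻¹' B, eexpNeg (sumBeyond X f (nearestDist X ω) ω) ∂P := by
        rw [lintegral_map _ hXm, ← lintegral_indicator (hRX hB)]
        · refine lintegral_congr fun ω => ?_
          by_cases hω : nearestDist X ω ∈ B
          · rw [indicator_of_mem (by exact hω), indicator_of_mem (by exact hω), Pi.one_apply,
              one_mul]
            rfl
          · rw [indicator_of_notMem (by exact hω), indicator_of_notMem (by exact hω), zero_mul]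
        · refine (measurable_one.indicator (hR hB)).mul (measurable_eexpNeg.comp ?_)
          -- Measurability is needed on sequence space, so the coordinate maps serve as the points.
          exact measurable_sumBeyond (X := fun i (x : ℕ → E) => x i)
            (fun i => measurable_pi_apply i) hf hR
    _ = ∫⁻ ω in nearestDist X ⁻¹' B, laplaceBeyond Λ f (nearestDist X ω) ∂P :=
        h.setLIntegral_sumBeyond_nearestDist hf hB
    _ = _ := by simp only [laplaceBeyond, hef]

end Marks

/-! ### Polar coordinates, Gamma fading and thinning -/

/-- The fundamental theorem of calculus for a monotone function, with values in `[0, ∞]`. -/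
lemma setLIntegral_Ioc_ofReal_deriv {g g' : ℝ → ℝ} {a b : ℝ} (hab : a ≤ b)
    (hg : ∀ x, HasDerivAt g (g' x) x) (hg' : Continuous g') (h0 : ∀ x ∈ Ioc a b, 0 ≤ g' x) :
    ∫⁻ x in Ioc a b, ENNReal.ofReal (g' x) = ENNReal.ofReal (g b - g a) := by
  rw [← intervalIntegral.integral_eq_sub_of_hasDerivAt (fun x _ => hg x)
    (hg'.intervalIntegrable a b), intervalIntegral.integral_of_le hab,
    ofReal_integral_eq_lintegral_ofReal]
  · exact (hg'.integrableOn_Icc (a := a) (b := b)).mono_set Ioc_subset_Icc_self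
  · exact (ae_restrict_iff' measurableSet_Ioc).2 (ae_of_all _ h0)

/-- The law of the norm under the Lebesgue measure of the plane. -/
lemma map_norm_volume_plane :
    (volume : Measure (EuclideanSpace ℝ (Fin 2))).map (fun x => ‖x‖) =
      (volume.restrict (Ioi 0)).withDensity fun r => ENNReal.ofReal (2 * Real.pi * r) := by
  -- The maximum with 0 covers negative radii, where the ball is empty.
  have hball : ∀ a : ℝ, (volume : Measure (EuclideanSpace ℝ (Fin 2))).map (fun x => ‖x‖) (Iic a) =
      ENNReal.ofReal (Real.pi * max a 0 ^ 2) := by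
    intro a
    rw [Measure.map_apply measurable_norm measurableSet_Iic]
    have : (fun x : EuclideanSpace ℝ (Fin 2) => ‖x‖) ⁻¹' Iic a = Metric.closedBall 0 a := by
      ext x; simp
    rw [this, EuclideanSpace.volume_closedBall_fin_two, mul_comm Real.pi,
      ENNReal.ofReal_mul (by positivity), ENNReal.ofReal_pow (by positivity)]
    congr 2
    rcases le_total a 0 with h | h <;> simp [h]
  have hdens : ∀ a : ℝ, (volume.restrict (Ioi 0)).withDensity
      (fun r => ENNReal.ofReal (2 * Real.pi * r)) (Iic a) =
      ENNReal.ofReal (Real.pi * max a 0 ^ 2) := by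
    intro a
    rw [withDensity_apply _ measurableSet_Iic, Measure.restrict_restrict measurableSet_Iic,
      inter_comm, Ioi_inter_Iic]
    rcases le_total a 0 with h | h
    · simp [h]
    rw [setLIntegral_Ioc_ofReal_deriv (g := fun r => Real.pi * r ^ 2) h]
    · simp [h]
    · intro x
      refine ((hasDerivAt_pow 2 x).const_mul Real.pi).congr_deriv ?_
      norm_num
      ring
    · fun_prop
    · intro x hx
      have := hx.1
      positivity
  refine Measure.ext_of_Ioc' _ _ (fun a b _ => ?_) fun a b hab => ?_
  · exact ((measure_mono Ioc_subset_Iic_self).trans_lt (by rw [hball]; simp)).ne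
  · rw [← Iic_sdiff_Iic, measure_sdiff (Iic_subset_Iic.2 hab.le) nullMeasurableSet_Iic
      (by rw [hball]; simp), measure_sdiff (Iic_subset_Iic.2 hab.le) nullMeasurableSet_Iic
      (by rw [hdens]; simp), hball, hball, hdens, hdens]

/-- Integration of radial functions over the exterior of a ball in the plane. -/
lemma setLIntegral_norm_gt_plane {h : ℝ → ℝ≥0∞} (hh : Measurable h) {R : ℝ} (hR : 0 ≤ R) :
    ∫⁻ x in {x : EuclideanSpace ℝ (Fin 2) | R < ‖x‖}, h ‖x‖ =
      ∫⁻ r in Ioi R, ENNReal.ofReal (2 * Real.pi * r) * h r := by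
  have h1 : {x : EuclideanSpace ℝ (Fin 2) | R < ‖x‖} = (fun x => ‖x‖) ⁻¹' Ioi R := rfl
  rw [h1, ← setLIntegral_map measurableSet_Ioi hh measurable_norm, map_norm_volume_plane,
    setLIntegral_withDensity_eq_setLIntegral_mul _ (by fun_prop) hh measurableSet_Ioi,
    Measure.restrict_restrict measurableSet_Ioi, inter_eq_left.2 (Ioi_subset_Ioi hR)]
  rfl

/-- The Laplace transform of the Gamma distribution with mean one. -/
lemma lintegral_eexpNeg_gammaMeasure {m c : ℝ} (hm : 0 < m) (hc : 0 ≤ c) :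
    ∫⁻ g, eexpNeg (ENNReal.ofReal (c * g)) ∂(gammaMeasure m m) =
      ENNReal.ofReal ((1 + c / m) ^ (-m)) := by
  have hmeas : Measurable fun g : ℝ => eexpNeg (ENNReal.ofReal (c * g)) :=
    measurable_eexpNeg.comp (by fun_prop)
  have hpdf : Measurable (gammaPDF m m) := (measurable_gammaPDFReal m m).ennreal_ofReal
  have hcm : 0 < m + c := by linarith
  have hpdf' : Measurable (gammaPDF m (m + c)) :=
    (measurable_gammaPDFReal m (m + c)).ennreal_ofReal
  have hk : 0 ≤ (1 + c / m) ^ (-m) := by positivity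
  rw [gammaMeasure, lintegral_withDensity_eq_lintegral_mul _ hpdf hmeas]
  -- Exponential tilting: e^{-cx} turns the density of rate m into a multiple of the density of rate
  -- m + c, which integrates to 1.
  have : ∀ x, (gammaPDF m m * fun g => eexpNeg (ENNReal.ofReal (c * g))) x =
      ENNReal.ofReal ((1 + c / m) ^ (-m)) * gammaPDF m (m + c) x := by
    intro x
    rw [Pi.mul_apply]
    rcases lt_or_ge x 0 with hx | hx
    · rw [gammaPDF_of_neg hx, gammaPDF_of_neg hx, zero_mul, mul_zero]
    · rw [gammaPDF_of_nonneg hx, gammaPDF_of_nonneg hx, eexpNeg_ofReal (by positivity),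
        ← ENNReal.ofReal_mul (by have := Real.Gamma_pos_of_pos hm; positivity),
        ← ENNReal.ofReal_mul hk]
      congr 1
      have h1 : (1 + c / m) ^ (-m) * (m + c) ^ m = m ^ m := by
        rw [show 1 + c / m = (m + c) / m by field_simp, Real.rpow_neg (by positivity),
          Real.div_rpow hcm.le hm.le]
        have h2 := (Real.rpow_pos_of_pos hcm m).ne'
        field_simp
      have h3 : Real.exp (-((m + c) * x)) = Real.exp (-(m * x)) * Real.exp (-(c * x)) := by
        rw [← Real.exp_add]; ring_nf
      rw [h3, ← h1]
      ring
  simp_rw [this]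
  rw [lintegral_const_mul _ hpdf', lintegral_gammaPDF_eq_one hm hcm, mul_one]

lemma uniform_Iic {a : ℝ} (h1 : a ≤ 1) :
    volume.restrict (Icc (0 : ℝ) 1) (Iic a) = ENNReal.ofReal a := by
  rw [Measure.restrict_apply measurableSet_Iic]
  have : Iic a ∩ Icc (0 : ℝ) 1 = Icc 0 a := by
    ext x; simp only [mem_inter_iff, mem_Iic, mem_Icc]; constructor
    · rintro ⟨h, h', -⟩; exact ⟨h', h⟩
    · rintro ⟨h, h'⟩; exact ⟨h', h, h'.trans h1⟩
  rw [this, Real.volume_Icc, sub_zero]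

lemma uniform_Ioi {a : ℝ} (h0 : 0 ≤ a) :
    volume.restrict (Icc (0 : ℝ) 1) (Ioi a) = ENNReal.ofReal (1 - a) := by
  rw [Measure.restrict_apply measurableSet_Ioi]
  have : Ioi a ∩ Icc (0 : ℝ) 1 = Ioc a 1 := by
    ext x; simp only [mem_inter_iff, mem_Ioi, mem_Icc, mem_Ioc]; constructor
    · rintro ⟨h, -, h'⟩; exact ⟨h, h'⟩
    · rintro ⟨h, h'⟩; exact ⟨h, h0.trans h.le, h'⟩
  rw [this, Real.volume_Ioc]

instance isProbabilityMeasure_uniform :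
    IsProbabilityMeasure (volume.restrict (Icc (0 : ℝ) 1)) := ⟨by simp⟩

open Classical in
/-- The Laplace transform of a thinned mixture: nothing with probability `1 - a`, the first
variable with probability `a q`, and the second variable with probability `a (1 - q)`. -/
lemma lintegral_thinning {ν₁ ν₂ : Measure ℝ} [IsProbabilityMeasure ν₁] [IsProbabilityMeasure ν₂]
    {φ₁ φ₂ : ℝ → ℝ≥0∞} (h₁ : Measurable φ₁) (h₂ : Measurable φ₂) {a q : ℝ} (ha : 0 ≤ a)
    (ha1 : a ≤ 1) (hq : 0 ≤ q) (hq1 : q ≤ 1) :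
    ∫⁻ m : ℝ × ℝ × ℝ × ℝ, eexpNeg ((if m.1 ≤ a ∧ m.2.1 ≤ q then φ₁ m.2.2.1 else 0) +
        (if m.1 ≤ a ∧ q < m.2.1 then φ₂ m.2.2.2 else 0))
      ∂((volume.restrict (Icc (0 : ℝ) 1)).prod ((volume.restrict (Icc (0 : ℝ) 1)).prod
        (ν₁.prod ν₂))) =
      ENNReal.ofReal (1 - a) + ENNReal.ofReal a *
        (ENNReal.ofReal q * ∫⁻ g, eexpNeg (φ₁ g) ∂ν₁ +
          ENNReal.ofReal (1 - q) * ∫⁻ g, eexpNeg (φ₂ g) ∂ν₂) := by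
  have e₁ : Measurable fun g => eexpNeg (φ₁ g) := measurable_eexpNeg.comp h₁
  have e₂ : Measurable fun g => eexpNeg (φ₂ g) := measurable_eexpNeg.comp h₂
  have m1 : Measurable fun b : ℝ => (Ioi a).indicator (1 : ℝ → ℝ≥0∞) b :=
    measurable_one.indicator measurableSet_Ioi
  have m2 : Measurable fun b : ℝ => (Iic a).indicator (1 : ℝ → ℝ≥0∞) b :=
    measurable_one.indicator measurableSet_Iic
  have m3 : Measurable fun b : ℝ => (Iic q).indicator (1 : ℝ → ℝ≥0∞) b :=
    measurable_one.indicator measurableSet_Iic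
  have m4 : Measurable fun b : ℝ => (Ioi q).indicator (1 : ℝ → ℝ≥0∞) b :=
    measurable_one.indicator measurableSet_Ioi
  -- The events not aligned, aligned LoS and aligned NLoS are disjoint and exhaustive, so at most
  -- one summand of the exponent survives.
  have hpt : ∀ m : ℝ × ℝ × ℝ × ℝ,
      eexpNeg ((if m.1 ≤ a ∧ m.2.1 ≤ q then φ₁ m.2.2.1 else 0) +
        (if m.1 ≤ a ∧ q < m.2.1 then φ₂ m.2.2.2 else 0)) =
      (Ioi a).indicator (1 : ℝ → ℝ≥0∞) m.1 + (Iic a).indicator (1 : ℝ → ℝ≥0∞) m.1 *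
        ((Iic q).indicator (1 : ℝ → ℝ≥0∞) m.2.1 * eexpNeg (φ₁ m.2.2.1) +
          (Ioi q).indicator (1 : ℝ → ℝ≥0∞) m.2.1 * eexpNeg (φ₂ m.2.2.2)) := by
    rintro ⟨b, k, g₁, g₂⟩
    by_cases hb : b ≤ a
    · by_cases hk : k ≤ q
      · simp [indicator, hb, hk, not_lt.2 hb, not_lt.2 hk]
      · simp [indicator, hb, hk, not_lt.2 hb, not_le.1 hk]
    · simp [indicator, hb, not_le.1 hb]
  simp_rw [hpt]
  have hin : ∫⁻ m : ℝ × ℝ × ℝ, ((Iic q).indicator (1 : ℝ → ℝ≥0∞) m.1 * eexpNeg (φ₁ m.2.1) +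
      (Ioi q).indicator (1 : ℝ → ℝ≥0∞) m.1 * eexpNeg (φ₂ m.2.2))
      ∂((volume.restrict (Icc (0 : ℝ) 1)).prod (ν₁.prod ν₂)) =
      ENNReal.ofReal q * ∫⁻ g, eexpNeg (φ₁ g) ∂ν₁ +
          ENNReal.ofReal (1 - q) * ∫⁻ g, eexpNeg (φ₂ g) ∂ν₂ := by
    rw [lintegral_add_left (by fun_prop)]
    congr 1
    · rw [lintegral_prod_mul (f := (Iic q).indicator (1 : ℝ → ℝ≥0∞))
        (g := fun z : ℝ × ℝ => eexpNeg (φ₁ z.1)) (by fun_prop) (by fun_prop),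
        lintegral_indicator_one measurableSet_Iic, uniform_Iic hq1, lintegral_prod _ (by fun_prop)]
      simp
    · rw [lintegral_prod_mul (f := (Ioi q).indicator (1 : ℝ → ℝ≥0∞))
        (g := fun z : ℝ × ℝ => eexpNeg (φ₂ z.2)) (by fun_prop) (by fun_prop),
        lintegral_indicator_one measurableSet_Ioi, uniform_Ioi hq, lintegral_prod _ (by fun_prop)]
      simp
  rw [lintegral_add_left (by fun_prop), lintegral_prod_mul (f := (Iic a).indicator (1 : ℝ → ℝ≥0∞))
    (g := fun m : ℝ × ℝ × ℝ => (Iic q).indicator (1 : ℝ → ℝ≥0∞) m.1 * eexpNeg (φ₁ m.2.1) +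
      (Ioi q).indicator (1 : ℝ → ℝ≥0∞) m.1 * eexpNeg (φ₂ m.2.2)) (by fun_prop) (by fun_prop),
    hin, lintegral_indicator_one measurableSet_Iic, uniform_Iic ha1, lintegral_prod _ (by fun_prop)]
  simp [lintegral_indicator_one measurableSet_Ioi, uniform_Ioi ha]

/-! ### Bounds on the parameters and the radial exponent -/

namespace Params

variable (p : Params)

lemma alignProb_nonneg : 0 ≤ p.alignProb := by unfold alignProb; positivity

/-- With x = θ_b / 2π, non-overlap gives N_b x ≤ 1, and also x ≤ 1 when N_b ≥ 1; the product of the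
two is the probability. -/
lemma alignProb_le_one : p.alignProb ≤ 1 := by
  have h2π : 0 < 2 * Real.pi := by positivity
  have hx : 0 ≤ p.θb / (2 * Real.pi) := div_nonneg p.θb_nonneg h2π.le
  have hN : p.Nb * (p.θb / (2 * Real.pi)) ≤ 1 := by
    rw [← mul_div_assoc, div_le_one h2π]
    exact p.beams_le
  rw [alignProb]
  rcases Nat.eq_zero_or_pos p.Nb with h0 | hpos
  · simp [h0]
  · have h1 : (1 : ℝ) ≤ p.Nb := by exact_mod_cast hpos
    have hx1 : p.θb / (2 * Real.pi) ≤ 1 := (le_mul_of_one_le_left hx h1).trans hN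
    calc p.Nb * (p.θb / (2 * Real.pi)) ^ 2
        = (p.Nb * (p.θb / (2 * Real.pi))) * (p.θb / (2 * Real.pi)) := by ring
      _ ≤ 1 := mul_le_one₀ hN hx hx1

lemma ξ_nonneg : 0 ≤ p.ξ := by
  have := p.lamBS_pos
  unfold ξ
  positivity

lemma pLOS_nonneg (r : ℝ) : 0 ≤ p.pLOS r := (Real.exp_pos _).le

lemma pLOS_le_one {r : ℝ} (hr : 0 ≤ r) : p.pLOS r ≤ 1 :=
  Real.exp_le_one_iff.2 (mul_nonpos_of_nonpos_of_nonneg (neg_nonpos.2 p.ηb_nonneg) hr)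

@[fun_prop] lemma measurable_pLOS : Measurable p.pLOS := by
  unfold pLOS
  fun_prop

/-- The Laplace transform of the power received from a LoS interferer at distance `r`. -/
noncomputable def gainL (s r : ℝ) : ℝ := (1 + s * p.Pc * p.Gm ^ 2 * p.CL * r ^ (-p.αL) / p.mL) ^ (-p.mL)

/-- The Laplace transform of the power received from an NLoS interferer at distance `r`. -/
noncomputable def gainN (s r : ℝ) : ℝ := (1 + s * p.Pc * p.Gm ^ 2 * p.CN * r ^ (-p.αN) / p.mN) ^ (-p.mN)

@[fun_prop] lemma measurable_gainL (s : ℝ) : Measurable (p.gainL s) := by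
  unfold gainL
  fun_prop

@[fun_prop] lemma measurable_gainN (s : ℝ) : Measurable (p.gainN s) := by
  unfold gainN
  fun_prop

lemma powerL_nonneg {s r : ℝ} (hs : 0 ≤ s) (hr : 0 ≤ r) :
    0 ≤ s * p.Pc * p.Gm ^ 2 * p.CL * r ^ (-p.αL) := by
  have := p.Pc_nonneg
  have := p.CL_nonneg
  positivity

lemma powerN_nonneg {s r : ℝ} (hs : 0 ≤ s) (hr : 0 ≤ r) :
    0 ≤ s * p.Pc * p.Gm ^ 2 * p.CN * r ^ (-p.αN) := by
  have := p.Pc_nonneg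
  have := p.CN_nonneg
  positivity

lemma gainL_mem {s r : ℝ} (hs : 0 ≤ s) (hr : 0 ≤ r) : p.gainL s r ∈ Icc (0 : ℝ) 1 := by
  have h := div_nonneg (p.powerL_nonneg hs hr) p.mL_pos.le
  exact ⟨Real.rpow_nonneg (by linarith) _,
    Real.rpow_le_one_of_one_le_of_nonpos (by linarith) (neg_nonpos.2 p.mL_pos.le)⟩

lemma gainN_mem {s r : ℝ} (hs : 0 ≤ s) (hr : 0 ≤ r) : p.gainN s r ∈ Icc (0 : ℝ) 1 := by
  have h := div_nonneg (p.powerN_nonneg hs hr) p.mN_pos.le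
  exact ⟨Real.rpow_nonneg (by linarith) _,
    Real.rpow_le_one_of_one_le_of_nonpos (by linarith) (neg_nonpos.2 p.mN_pos.le)⟩

lemma measurable_JL (s : ℝ) : Measurable (p.JL s) :=
  Antitone.measurable fun _ _ h => lintegral_mono_set (Ioi_subset_Ioi h)

lemma measurable_JN (s : ℝ) : Measurable (p.JN s) :=
  Antitone.measurable fun _ _ h => lintegral_mono_set (Ioi_subset_Ioi h)

/-- A zero weight removes one interference type from the exponent, leaving the transform of the
other alone. -/
lemma JL_zero (R : ℝ) : p.JL 0 R = 0 := by simp [JL]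

lemma JN_zero (R : ℝ) : p.JN 0 R = 0 := by simp [JN]

/-- The probability that an interferer at distance `r` is aligned, weighted by the expected loss
of the Laplace transform. -/
noncomputable def loss (sL sN r : ℝ) : ℝ := p.alignProb *
  (p.pLOS r * (1 - p.gainL sL r) + (1 - p.pLOS r) * (1 - p.gainN sN r))

@[fun_prop] lemma measurable_loss (sL sN : ℝ) : Measurable (p.loss sL sN) := by
  unfold loss
  fun_prop

/-- Polar coordinates contribute 2πr, the intensity contributes λ, and the loss carries the
alignment probability; the constants multiply to ξ. -/
lemma setLIntegral_loss {sL sN R : ℝ} (hL : 0 ≤ sL) (hN : 0 ≤ sN) (hR : 0 ≤ R) :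
    ∫⁻ x in {x : EuclideanSpace ℝ (Fin 2) | R < ‖x‖}, ENNReal.ofReal (p.loss sL sN ‖x‖)
      ∂(ENNReal.ofReal p.lamBS • (volume : Measure (EuclideanSpace ℝ (Fin 2)))) =
      ENNReal.ofReal p.ξ * (p.JL sL R + p.JN sN R) := by
  have hJL : p.JL sL R = ∫⁻ r in Ioi R, ENNReal.ofReal (p.pLOS r * (1 - p.gainL sL r) * r) := rfl
  have hJN : p.JN sN R =
      ∫⁻ r in Ioi R, ENNReal.ofReal ((1 - p.pLOS r) * (1 - p.gainN sN r) * r) := rfl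
  rw [Measure.restrict_smul, lintegral_smul_measure, smul_eq_mul,
    setLIntegral_norm_gt_plane (h := fun r => ENNReal.ofReal (p.loss sL sN r)) (by fun_prop) hR,
    hJL, hJN, ← lintegral_add_left (by fun_prop), ← lintegral_const_mul _ (by fun_prop),
    ← lintegral_const_mul _ (by fun_prop)]
  refine setLIntegral_congr_fun measurableSet_Ioi fun r hr => ?_
  have hr0 : 0 ≤ r := hR.trans (le_of_lt hr)
  have h1 := p.pLOS_nonneg r
  have h2 : 0 ≤ 1 - p.pLOS r := sub_nonneg.2 (p.pLOS_le_one hr0)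
  have h3 : 0 ≤ 1 - p.gainL sL r := sub_nonneg.2 (p.gainL_mem hL hr0).2
  have h4 : 0 ≤ 1 - p.gainN sN r := sub_nonneg.2 (p.gainN_mem hN hr0).2
  rw [← ENNReal.ofReal_add (by positivity) (by positivity), ← ENNReal.ofReal_mul p.ξ_nonneg,
    ← ENNReal.ofReal_mul (by positivity), ← ENNReal.ofReal_mul p.lamBS_pos.le]
  congr 1
  rw [loss, ξ, alignProb]
  ring

end Params

/-! ### The marked network and its exclusion radius -/

namespace Network

instance (p : Params) : SigmaFinite
    (ENNReal.ofReal p.lamBS • (volume : Measure (EuclideanSpace ℝ (Fin 2)))) :=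
  inferInstanceAs (SigmaFinite (p.lamBS.toNNReal • (volume : Measure (EuclideanSpace ℝ (Fin 2)))))

variable {Ω : Type*} [MeasurableSpace Ω] {P : Measure Ω} {p : Params} (N : Network P p)

/-- The mark of the `i`-th BS. -/
def mark (i : ℕ) (ω : Ω) : ℝ × ℝ × ℝ × ℝ := (N.beam i ω, N.block i ω, N.gL i ω, N.gN i ω)

open Classical in
/-- The weighted power that is received from a BS at `z.1` with mark `z.2`. -/
noncomputable def power (p : Params) (sL sN : ℝ) (z : EuclideanSpace ℝ (Fin 2) × ℝ × ℝ × ℝ × ℝ) : ℝ≥0∞ :=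
  (if z.2.1 ≤ p.alignProb ∧ z.2.2.1 ≤ p.pLOS ‖z.1‖ then
    ENNReal.ofReal (sL * p.Pc * p.Gm ^ 2 * p.CL * ‖z.1‖ ^ (-p.αL) * z.2.2.2.1) else 0) +
  (if z.2.1 ≤ p.alignProb ∧ p.pLOS ‖z.1‖ < z.2.2.1 then
    ENNReal.ofReal (sN * p.Pc * p.Gm ^ 2 * p.CN * ‖z.1‖ ^ (-p.αN) * z.2.2.2.2) else 0)

lemma measurable_power (p : Params) (sL sN : ℝ) : Measurable (power p sL sN) := by
  unfold power
  have hb : MeasurableSet {z : EuclideanSpace ℝ (Fin 2) × ℝ × ℝ × ℝ × ℝ | z.2.1 ≤ p.alignProb} :=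
    measurableSet_le (by fun_prop) (by fun_prop)
  have hL : MeasurableSet
      {z : EuclideanSpace ℝ (Fin 2) × ℝ × ℝ × ℝ × ℝ | z.2.2.1 ≤ p.pLOS ‖z.1‖} :=
    measurableSet_le (by fun_prop) (by fun_prop)
  have hN : MeasurableSet
      {z : EuclideanSpace ℝ (Fin 2) × ℝ × ℝ × ℝ × ℝ | p.pLOS ‖z.1‖ < z.2.2.1} :=
    measurableSet_lt (by fun_prop) (by fun_prop)
  exact Measurable.add (Measurable.ite (hb.inter hL) (by fun_prop) measurable_const)
    (Measurable.ite (hb.inter hN) (by fun_prop) measurable_const)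

/-- The weighted sum of the LoS and the NLoS interference. -/
noncomputable def interference (sL sN : ℝ) (ω : Ω) : ℝ≥0∞ :=
  ENNReal.ofReal sL * N.IL ω + ENNReal.ofReal sN * N.IN ω

/-- Both interferences become one sum over the same marked points, as the marked Poisson theorem
requires. The two terms of `power` exclude each other through the blockage mark. -/
lemma interference_eq {sL sN : ℝ} (hL : 0 ≤ sL) (hN : 0 ≤ sN) (ω : Ω) :
    N.interference sL sN ω = ∑' i, {x : EuclideanSpace ℝ (Fin 2) | nearestDist N.X ω < ‖x‖}.indicator
      (fun x => power p sL sN (x, N.mark i ω)) (N.X i ω) := by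
  classical
  have hPc := p.Pc_nonneg
  have hCL := p.CL_nonneg
  have hCN := p.CN_nonneg
  rw [interference, IL, IN, ← mul_assoc, ← mul_assoc, ← ENNReal.ofReal_mul hL,
    ← ENNReal.ofReal_mul hN, ← ENNReal.tsum_mul_left, ← ENNReal.tsum_mul_left, ← ENNReal.tsum_add]
  congr 1
  ext i
  have h1 : ENNReal.ofReal (sL * (p.Pc * p.Gm ^ 2 * p.CL)) *
      ENNReal.ofReal (N.gL i ω * ‖N.X i ω‖ ^ (-p.αL)) =
      ENNReal.ofReal (sL * p.Pc * p.Gm ^ 2 * p.CL * ‖N.X i ω‖ ^ (-p.αL) * N.gL i ω) := by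
    rw [← ENNReal.ofReal_mul (by positivity)]
    ring_nf
  have h2 : ENNReal.ofReal (sN * (p.Pc * p.Gm ^ 2 * p.CN)) *
      ENNReal.ofReal (N.gN i ω * ‖N.X i ω‖ ^ (-p.αN)) =
      ENNReal.ofReal (sN * p.Pc * p.Gm ^ 2 * p.CN * ‖N.X i ω‖ ^ (-p.αN) * N.gN i ω) := by
    rw [← ENNReal.ofReal_mul (by positivity)]
    ring_nf
  by_cases hR : nearestDist N.X ω < ‖N.X i ω‖
  · have hR' : N.RI ω < ‖N.X i ω‖ := hR
    rw [indicator_of_mem (by exact hR)]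
    simp only [hR', and_true, mul_ite, mul_zero, h1, h2, power, mark, ΦL, ΦN, mem_ofPred_eq]
    congr
  · have hR' : ¬ N.RI ω < ‖N.X i ω‖ := hR
    rw [indicator_of_notMem (by exact hR)]
    simp [hR']

lemma measurable_RI : Measurable N.RI := measurable_nearestDist N.poisson.measurable

lemma measurable_interference {sL sN : ℝ} (hL : 0 ≤ sL) (hN : 0 ≤ sN) :
    Measurable (N.interference sL sN) := by
  have : N.interference sL sN = fun ω => ∑' i,
      {ω | N.RI ω < ‖N.X i ω‖}.indicator (fun ω => power p sL sN (N.X i ω, N.mark i ω)) ω := by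
    ext ω
    rw [N.interference_eq hL hN]
    congr 1
  rw [this]
  exact Measurable.tsum fun i => ((measurable_power p sL sN).comp
    ((N.poisson.measurable i).prodMk (N.measurable_mark i))).indicator
    (measurableSet_lt N.measurable_RI (N.poisson.measurable i).norm)

/-- The law of a mark. -/
noncomputable def markLaw (p : Params) : Measure (ℝ × ℝ × ℝ × ℝ) :=
  (volume.restrict (Icc (0 : ℝ) 1)).prod ((volume.restrict (Icc (0 : ℝ) 1)).prod
    ((gammaMeasure p.mL p.mL).prod (gammaMeasure p.mN p.mN)))

instance (p : Params) : IsProbabilityMeasure (gammaMeasure p.mL p.mL) :=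
  isProbabilityMeasure_gammaMeasure p.mL_pos p.mL_pos

instance (p : Params) : IsProbabilityMeasure (gammaMeasure p.mN p.mN) :=
  isProbabilityMeasure_gammaMeasure p.mN_pos p.mN_pos

instance (p : Params) : IsProbabilityMeasure (markLaw p) := by
  unfold markLaw
  infer_instance

/-- Writing 1 = (1 - a) + a(q + (1 - q)) cancels the unaligned part and leaves the loss of each link
type weighted by its probability. -/
lemma one_sub_lintegral_power (p : Params) {sL sN : ℝ} (hL : 0 ≤ sL) (hN : 0 ≤ sN)
    (x : EuclideanSpace ℝ (Fin 2)) :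
    1 - ∫⁻ m, eexpNeg (power p sL sN (x, m)) ∂(markLaw p) =
      ENNReal.ofReal (p.loss sL sN ‖x‖) := by
  have hr := norm_nonneg x
  have hq0 := p.pLOS_nonneg ‖x‖
  have hq1 := p.pLOS_le_one hr
  have ha0 := p.alignProb_nonneg
  have ha1 := p.alignProb_le_one
  obtain ⟨hA0, hA1⟩ := p.gainL_mem hL hr
  obtain ⟨hB0, hB1⟩ := p.gainN_mem hN hr
  have hq1' := sub_nonneg.2 hq1
  have ha1' := sub_nonneg.2 ha1
  have key := lintegral_thinning (ν₁ := gammaMeasure p.mL p.mL) (ν₂ := gammaMeasure p.mN p.mN)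
    (φ₁ := fun g => ENNReal.ofReal (sL * p.Pc * p.Gm ^ 2 * p.CL * ‖x‖ ^ (-p.αL) * g))
    (φ₂ := fun g => ENNReal.ofReal (sN * p.Pc * p.Gm ^ 2 * p.CN * ‖x‖ ^ (-p.αN) * g))
    (by fun_prop) (by fun_prop) ha0 ha1 hq0 hq1
  rw [lintegral_eexpNeg_gammaMeasure p.mL_pos (p.powerL_nonneg hL hr),
    lintegral_eexpNeg_gammaMeasure p.mN_pos (p.powerN_nonneg hN hr)] at key
  change _ = ENNReal.ofReal (1 - p.alignProb) + ENNReal.ofReal p.alignProb *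
    (ENNReal.ofReal (p.pLOS ‖x‖) * ENNReal.ofReal (p.gainL sL ‖x‖) +
      ENNReal.ofReal (1 - p.pLOS ‖x‖) * ENNReal.ofReal (p.gainN sN ‖x‖)) at key
  rw [← ENNReal.ofReal_mul hq0, ← ENNReal.ofReal_mul hq1', ← ENNReal.ofReal_add (by positivity)
    (by positivity), ← ENNReal.ofReal_mul ha0, ← ENNReal.ofReal_add ha1' (by positivity)] at key
  rw [markLaw]
  simp only [power]
  rw [key, ← ENNReal.ofReal_one, ← ENNReal.ofReal_sub _ (by positivity), Params.loss]
  ring_nf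

/-- The joint law of the exclusion radius and the interference. -/
theorem setLIntegral_eexpNeg_interference [IsProbabilityMeasure P] {sL sN : ℝ} (hL : 0 ≤ sL)
    (hN : 0 ≤ sN) {B : Set ℝ} (hB : MeasurableSet B) :
    ∫⁻ ω in N.RI ⁻¹' B, eexpNeg (N.interference sL sN ω) ∂P =
      ∫⁻ ω in N.RI ⁻¹' B,
        eexpNeg (ENNReal.ofReal p.ξ * (p.JL sL (N.RI ω) + p.JN sN (N.RI ω))) ∂P := by
  have key := N.poisson.setLIntegral_marked (Y := N.mark) (μ := markLaw p) N.measurable_mark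
    N.indep_marks N.law_mark N.indep_points_marks (measurable_power p sL sN) hB
  simp_rw [← N.interference_eq hL hN, one_sub_lintegral_power p hL hN] at key
  refine key.trans (lintegral_congr fun ω => ?_)
  rw [p.setLIntegral_loss hL hN (nearestDist_nonneg ω)]
  rfl

/-- The law of the exclusion radius. -/
theorem map_RI [IsProbabilityMeasure P] : P.map N.RI =
    (volume.restrict (Ioi (0 : ℝ))).withDensity (fun r => ENNReal.ofReal (p.fRI r)) := by
  have hlam := p.lamBS_pos
  have := Measure.isProbabilityMeasure_map (μ := P) N.measurable_RI.aemeasurable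
  refine Measure.ext_of_Ici _ _ fun a => ?_
  rw [Measure.map_apply N.measurable_RI measurableSet_Ici]
  have h1 : N.RI ⁻¹' Ici a = {ω | a ≤ nearestDist N.X ω} := rfl
  have hball : (ENNReal.ofReal p.lamBS • (volume : Measure (EuclideanSpace ℝ (Fin 2))))
      (Metric.ball 0 a) = ENNReal.ofReal (Real.pi * p.lamBS * max a 0 ^ 2) := by
    rw [Measure.smul_apply, smul_eq_mul, EuclideanSpace.volume_ball_fin_two, mul_assoc Real.pi,
      mul_comm Real.pi, ENNReal.ofReal_mul (by positivity), ENNReal.ofReal_mul (by positivity),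
      ENNReal.ofReal_pow (by positivity), mul_assoc]
    congr 3
    rcases le_total a 0 with h | h <;> simp [h]
  rw [h1, N.poisson.measure_le_nearestDist, hball, eexpNeg_ofReal (by positivity),
    withDensity_apply _ measurableSet_Ici, Measure.restrict_restrict measurableSet_Ici]
  have h2 : (Ici a ∩ Ioi 0 : Set ℝ) =ᵐ[volume] Ioi (max a 0) := by
    rw [← Ioi_inter_Ioi]
    exact Ioi_ae_eq_Ici.symm.inter (ae_eq_refl _)
  rw [setLIntegral_congr h2]
  set c := max a 0
  have hc : 0 ≤ c := le_max_right _ _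
  -- The antiderivative of the density is minus the void probability, so the tail integral is the
  -- void probability at c.
  have hderiv : ∀ x ∈ Ici c, HasDerivAt (fun r => -Real.exp (-(Real.pi * p.lamBS * r ^ 2)))
      (p.fRI x) x := by
    intro x _
    refine ((((hasDerivAt_pow 2 x).const_mul (Real.pi * p.lamBS)).neg).exp.neg).congr_deriv ?_
    simp only [Params.fRI]
    norm_num
    ring
  have hpos : ∀ x ∈ Ioi c, 0 ≤ p.fRI x := by
    intro x hx
    have : 0 ≤ x := hc.trans (le_of_lt hx)
    unfold Params.fRI
    positivity
  have hlim : Tendsto (fun r => -Real.exp (-(Real.pi * p.lamBS * r ^ 2))) atTop (𝓝 0) := by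
    rw [← neg_zero]
    refine (Real.tendsto_exp_neg_atTop_nhds_zero.comp ?_).neg
    exact (tendsto_pow_atTop two_ne_zero).const_mul_atTop (by positivity)
  rw [← ofReal_integral_eq_lintegral_ofReal
    (integrableOn_Ioi_deriv_of_nonneg' hderiv hpos hlim)
    ((ae_restrict_iff' measurableSet_Ioi).2 (ae_of_all _ hpos)),
    integral_Ioi_of_hasDerivAt_of_nonneg' hderiv hpos hlim]
  simp

end Network

/-! ### From integrals over events to conditional expectations -/

lemma measurable_expNeg : Measurable expNeg := by
  have : expNeg = fun x => (eexpNeg x).toReal := funext fun x => (toReal_eexpNeg x).symm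
  rw [this]
  exact measurable_eexpNeg.ennreal_toReal

lemma expNeg_le_one (x : ℝ≥0∞) : expNeg x ≤ 1 := by
  have := eexpNeg_le_one x
  rwa [eexpNeg, ENNReal.ofReal_le_one] at this

section CondExp

variable {Ω : Type*} [mΩ : MeasurableSpace Ω] {P : Measure Ω}

lemma integrable_expNeg [IsFiniteMeasure P] {W : Ω → ℝ≥0∞} (hW : Measurable W) :
    Integrable (fun ω => expNeg (W ω)) P := by
  refine Integrable.of_bound (measurable_expNeg.comp hW).aestronglyMeasurable 1
    (ae_of_all _ fun ω => ?_)
  rw [Real.norm_of_nonneg (expNeg_nonneg _)]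
  exact expNeg_le_one _

lemma integral_expNeg_eq_toReal {W : Ω → ℝ≥0∞} (hW : Measurable W) :
    ∫ ω, expNeg (W ω) ∂P = (∫⁻ ω, eexpNeg (W ω) ∂P).toReal :=
  integral_eq_lintegral_of_nonneg_ae (ae_of_all _ fun _ => expNeg_nonneg _)
    (measurable_expNeg.comp hW).aestronglyMeasurable

/-- A conditional Laplace transform is determined by the integrals over the events in the
conditioning σ-algebra. -/
lemma condExp_expNeg_ae_eq [IsProbabilityMeasure P] {W : Ω → ℝ≥0∞} (hW : Measurable W)
    {R : Ω → ℝ} (hR : Measurable R) {K : ℝ → ℝ≥0∞} (hK : Measurable K)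
    (h : ∀ B, MeasurableSet B →
      ∫⁻ ω in R ⁻¹' B, eexpNeg (W ω) ∂P = ∫⁻ ω in R ⁻¹' B, eexpNeg (K (R ω)) ∂P) :
    P[fun ω => expNeg (W ω) | MeasurableSpace.comap R inferInstance] =ᵐ[P]
      fun ω => expNeg (K (R ω)) := by
  have hKR : Measurable fun ω => K (R ω) := hK.comp hR
  refine (ae_eq_condExp_of_forall_setIntegral_eq hR.comap_le (integrable_expNeg hW)
    (fun s _ _ => (integrable_expNeg hKR).integrableOn) ?_ ?_).symm
  -- Events of the σ-algebra generated by R are exactly preimages of Borel sets.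
  · rintro s ⟨B, hB, rfl⟩ -
    rw [integral_expNeg_eq_toReal hKR, integral_expNeg_eq_toReal hW, h B hB]
  · exact ((measurable_expNeg.comp hK).comp
      (comap_measurable R)).stronglyMeasurable.aestronglyMeasurable

end CondExp

end MmWave

/-! ### The main theorem -/

theorem lemma1 {Ω : Type*} [MeasurableSpace Ω] (P : Measure Ω) [IsProbabilityMeasure P]
    (p : MmWave.Params) (N : MmWave.Network P p) (s : ℝ) (hs : 0 ≤ s) :
    -- the exclusion radius has density `fRI` on `(0, ∞)`
    P.map N.RI = (volume.restrict (Ioi (0 : ℝ))).withDensity (fun r => ENNReal.ofReal (p.fRI r)) ∧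
    -- the conditional Laplace transforms given the exclusion radius
    MmWave.condLaplaceTransform P N.IL N.RI s =ᵐ[P]
      (fun ω => MmWave.expNeg (ENNReal.ofReal p.ξ * p.JL s (N.RI ω))) ∧
    MmWave.condLaplaceTransform P N.IN N.RI s =ᵐ[P]
      (fun ω => MmWave.expNeg (ENNReal.ofReal p.ξ * p.JN s (N.RI ω))) ∧
    -- the conditional transform of the aggregate interference is the product
    MmWave.condLaplaceTransform P (fun ω => N.IL ω + N.IN ω) N.RI s =ᵐ[P]
      (fun ω => MmWave.condLaplaceTransform P N.IL N.RI s ω *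
        MmWave.condLaplaceTransform P N.IN N.RI s ω) ∧
    -- the transform of the aggregate interference is the average of that product
    MmWave.laplaceTransform P (fun ω => N.IL ω + N.IN ω) s =
      ∫ ω, MmWave.condLaplaceTransform P N.IL N.RI s ω *
        MmWave.condLaplaceTransform P N.IN N.RI s ω ∂P ∧
    -- and it has the closed integral form
    MmWave.laplaceTransform P (fun ω => N.IL ω + N.IN ω) s =
      ∫ R in Ioi (0 : ℝ),
        MmWave.expNeg (ENNReal.ofReal p.ξ * (p.JL s R + p.JN s R)) * p.fRI R := by
  open MmWave in
  have hR := N.measurable_RI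
  -- Used with weights (s, 0), (0, s) and (s, s) for the LoS, NLoS and aggregate transforms.
  have hcond : ∀ sL sN : ℝ, 0 ≤ sL → 0 ≤ sN →
      P[fun ω => expNeg (N.interference sL sN ω) | MeasurableSpace.comap N.RI inferInstance]
        =ᵐ[P] fun ω => expNeg (ENNReal.ofReal p.ξ * (p.JL sL (N.RI ω) + p.JN sN (N.RI ω))) :=
    fun sL sN hL hN => condExp_expNeg_ae_eq (N.measurable_interference hL hN) hR
      (K := fun r => ENNReal.ofReal p.ξ * (p.JL sL r + p.JN sN r))
      (((p.measurable_JL sL).add (p.measurable_JN sN)).const_mul _)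
      fun B hB => N.setLIntegral_eexpNeg_interference hL hN hB
  have hcL : condLaplaceTransform P N.IL N.RI s =ᵐ[P]
      (fun ω => expNeg (ENNReal.ofReal p.ξ * p.JL s (N.RI ω))) := by
    simpa [condLaplaceTransform, Network.interference, p.JN_zero] using hcond s 0 hs le_rfl
  have hcN : condLaplaceTransform P N.IN N.RI s =ᵐ[P]
      (fun ω => expNeg (ENNReal.ofReal p.ξ * p.JN s (N.RI ω))) := by
    simpa [condLaplaceTransform, Network.interference, p.JL_zero] using hcond 0 s le_rfl hs
  have hI : (fun ω => expNeg (ENNReal.ofReal s * (N.IL ω + N.IN ω))) =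
      fun ω => expNeg (N.interference s s ω) := by
    simp [Network.interference, mul_add]
  have hcS : condLaplaceTransform P (fun ω => N.IL ω + N.IN ω) N.RI s =ᵐ[P]
      (fun ω => expNeg (ENNReal.ofReal p.ξ * (p.JL s (N.RI ω) + p.JN s (N.RI ω)))) := by
    rw [condLaplaceTransform, hI]
    exact hcond s s hs hs
  have hprod : condLaplaceTransform P (fun ω => N.IL ω + N.IN ω) N.RI s =ᵐ[P]
      (fun ω => condLaplaceTransform P N.IL N.RI s ω * condLaplaceTransform P N.IN N.RI s ω) := by
    filter_upwards [hcL, hcN, hcS] with ω h1 h2 h3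
    rw [h1, h2, h3, mul_add, expNeg_add]
  -- The tower property.
  have hint : laplaceTransform P (fun ω => N.IL ω + N.IN ω) s =
      ∫ ω, condLaplaceTransform P (fun ω => N.IL ω + N.IN ω) N.RI s ω ∂P :=
    (integral_condExp hR.comap_le).symm
  refine ⟨N.map_RI, hcL, hcN, hprod, hint.trans (integral_congr_ae hprod), ?_⟩
  have hK : Measurable fun r => expNeg (ENNReal.ofReal p.ξ * (p.JL s r + p.JN s r)) :=
    measurable_expNeg.comp (((p.measurable_JL s).add (p.measurable_JN s)).const_mul _)
  have hf : Measurable p.fRI := by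
    unfold Params.fRI
    fun_prop
  rw [hint, integral_congr_ae hcS, ← integral_map (φ := N.RI)
    (f := fun r => expNeg (ENNReal.ofReal p.ξ * (p.JL s r + p.JN s r))) hR.aemeasurable
    hK.aestronglyMeasurable, N.map_RI, integral_withDensity_eq_integral_toReal_smul
    hf.ennreal_ofReal (ae_of_all _ fun _ => ENNReal.ofReal_lt_top)]
  refine setIntegral_congr_fun measurableSet_Ioi fun r hr => ?_
  have hlam := p.lamBS_pos
  have hr0 : 0 < r := hr
  have : 0 ≤ p.fRI r := by
    unfold Params.fRI
    positivity
  simp only [ENNReal.toReal_ofReal this, smul_eq_mul]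
  rw [mul_comm]
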